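/- **Setting.** Graphs are directed multigraphs; for a graph $T$, $T$-typed graphs are graphs with a morphism to $T$, with morphisms commuting with the typing. A rule is a span $L\leftarrow K\to R$ of monos of typed graphs, a match is a mono $m:L\to G$, and $G\Rightarrow_{p,m}H$ is a transformation if there is a double-pushout (DPO) diagram $G\xleftarrow{g}D\xrightarrow{h}H$ with comatch $m^*:R\to H$. A constraint is a mono $n:L\to N$; $m\models n$ if no mono $q:N\to G$ has $q\circ n=m$. A conditional grammar $\mathcal{CG}=\langle TG,G_{in},P,\pi,\mathcal N\rangle$ consists of a type graph, an input graph, rule names, a rule $\pi(p)$ and a set $\mathcal N(p)$ of constraints over its left-hand side for each $p\in P$. Conditional transformations are transformations whose match satisfies $\mathcal N(p)$; derivations are finite sequences of them starting from $G_{in}$, and the graphs at which they end are reachable. Let $\mathcal{CG}$ be a *safe* conditional grammar (all graphs in rules and constraints and all reachable graphs are injectively typed, so that the former are regarded as subgraphs of $TG$) such that every constraint $n:L\to N$ is not an isomorphism and is *incremental* (of any two decompositions $L\to X_i\to N$ of $n$ into monos, one factors through the other). **The grammar $E(\mathcal{CG})$.** The shape of $n:L\to N$ is $n^-:L^-\to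 N^-$, where the body $N^-$ is the smallest subgraph of $N$ containing all items outside $L$ and the border is $L^-=N^-\cap L$. The type graph $\overline{TG}$ is obtained from $TG$ by adding, for each shape, a fresh copy of $N^-\setminus L^-$, glued along $L^-$; $\overline N^-$ denotes $L^-$ together with this copy. The input graph is $G_{in}$ together with $\overline N^-$ for all shapes with $L^-\subseteq G_{in}$, $N^-\not\subseteq G_{in}$. Each rule $p=(L\leftarrow K\to R)$ is changed as follows. 0. For each shape of a constraint of $p$: add $\overline N^-$ to $L$; add it also to $K$ and $R$ if $p$ has a DPO transformation at $L\hookrightarrow L\cup\overline N^-$ and $N^-\not\subseteq R$. Then, for the shapes that are not shapes of constraints of $p$, and with $L,K,R$ always the current graphs, in this order: 1. add $\overline N^-$ to $R$ if $N^-\subseteq L$, $N^-\not\subseteq K$, $L^-\subseteq K$; 2. add $\overline N^-$ to $L$ if $N^-\subseteq R$, $N^-\not\subseteq K$, $L^-\subseteq K$; 3. add $\overline N^-$ to $R$ if $L^-\subseteq R$, $L^-\not\subseteq K$, $N^-\not\subseteq R$; 4. starting with the rule obtained so far, close the set of rules under the following extension: for a shape whose border consists of two distinct nodes and whose body adds one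 arc between them, if $L^-\not\subseteq R$ and $K\cap L^-\neq R\cap L^-$, add the node of $L^-\setminus R$ to $L$, $K$ (disjointly, by pushout) and $R$, and add $\overline N^-$ to $R$. The rules of $E(\mathcal{CG})$ are all the rules so obtained from the rules of $\mathcal{CG}$; their constraints are those of the original rules, pushed out along the extension of the left-hand side. $DE(\mathcal{CG})$ is $E(\mathcal{CG})$ with all constraints deleted. **Morphisms and independence.** A morphism $\mathcal{CG}_1\to\mathcal{CG}_2$ is a pair of a span $TG_1\hookleftarrow TG_0\to TG_2$ (left leg mono) and a map $f_P:P_1\to P_2$ such that, with $F$ the retyping functor (pull back along the left leg, compose with the right leg): (1) $F(G_{in,1})\cong G_{in,2}$; (2) for each $p\in P_1$ there is a DPO diagram with mono verticals, $i_p:L_{f_P(p)}\to F(L_p)$ among them, from $\pi_2(f_P(p))$ to $F(\pi_1(p))$; and (3), for this $i_p$: for every mono $h:L_p\to N$ such that $F(h)$ is a pushout of some $n'\in\mathcal N_2(f_P(p))$ along $i_p$, there is $n\in\mathcal N_1(p)$ such that every match satisfying $n$ satisfies $h$. The image of a transformation is the retyped transformation below such a diagram (2). Two consecutive conditional transformations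 $G\Rightarrow_{p_1,m_1}H_1\Rightarrow_{p_2,m_2}H_2$ (with $G\leftarrow^{g_1}D_1\to^{h_1}H_1\leftarrow^{g_2}D_2\to H_2$) are sequentially independent if there are $i:R_1\to D_2$, $j:L_2\to D_1$ with $g_2 i=m_1^*$, $h_1 j=m_2$, such that $g_1 j\models\mathcal N(p_2)$ and there is a transformation $G\Rightarrow_{p_2,g_1j}H'$ for which the induced match of $p_1$ in $H'$ satisfies $\mathcal N(p_1)$. **Proposition.** The pair $d$ of the identity span on $\overline{TG}$ and the identity on rule names is a morphism $d:E(\mathcal{CG})\to DE(\mathcal{CG})$. It preserves and reflects derivations: up to isomorphism, the derivations of $DE(\mathcal{CG})$ are exactly the images of the derivations of $E(\mathcal{CG})$; moreover, at each step of a derivation of $DE(\mathcal{CG})$ the match satisfies the constraints that the rule has in $E(\mathcal{CG})$. It preserves and reflects sequential independence: two consecutive transformations in a derivation of $E(\mathcal{CG})$ are sequentially independent in $E(\mathcal{CG})$ if and only if their images are sequentially independent in $DE(\mathcal{CG})$. -/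

import Mathlib

open CategoryTheory CategoryTheory.Limits

universe u v

namespace GraphGrammar

/-! ### Graphs and typed graphs -/

/-- A directed, unlabelled (multi)graph: nodes, arcs, source and target. -/
structure Gph : Type (u + 1) where
  N : Type u
  E : Type u
  s : E → N
  t : E → N

/-- Graph morphisms: pairs of functions preserving sources and targets. -/
@[ext]
structure Gph.Hom (G H : Gph.{u}) : Type u where
  n : G.N → H.N
  e : G.E → H.E
  hs : ∀ x, n (G.s x) = H.s (e x)
  ht : ∀ x, n (G.t x) = H.t (e x)

instance : Category.{u} Gph.{u} where
  Hom := Gph.Hom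
  id G := ⟨id, id, fun _ => rfl, fun _ => rfl⟩
  comp f g := ⟨g.n ∘ f.n, g.e ∘ f.e,
    fun x => by simp [f.hs, g.hs], fun x => by simp [f.ht, g.ht]⟩

/-- Both components are injective (the monomorphisms of graphs). -/
def Gph.Inj {G H : Gph.{u}} (f : G ⟶ H) : Prop :=
  Function.Injective f.n ∧ Function.Injective f.e

/-- Both components are bijective (the isomorphisms of graphs). -/
def Gph.Bij {G H : Gph.{u}} (f : G ⟶ H) : Prop :=
  Function.Bijective f.n ∧ Function.Bijective f.e

/-- The category of `T`-typed graphs: pairs of a graph and a morphism to `T`, with the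
morphisms that commute with the typing. -/
abbrev TGph (T : Gph.{u}) : Type (u + 1) := Over T

/-- A morphism of typed graphs is mono. -/
abbrev Inj {T : Gph.{u}} {A B : TGph T} (f : A ⟶ B) : Prop := Gph.Inj f.left

/-! ### Rules, double-pushout transformations, constraints -/

/-- A rule: a span of monos of typed graphs. -/
structure Rule (T : Gph.{u}) : Type (u + 1) where
  L : TGph T
  K : TGph T
  R : TGph T
  l : K ⟶ L
  r : K ⟶ R
  l_inj : Inj l
  r_inj : Inj r

/-- The objects and arrows of a double-pushout diagram
```
  L <-l-- K --r-> R
  |m      |d      |c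
  G <-g-- D --h-> H
```
(whether it is one is said by `IsDPO`). -/
structure Diagram {T : Gph.{u}} (p : Rule T) (G H : TGph T) : Type (u + 1) where
  D : TGph T
  m : p.L ⟶ G
  d : p.K ⟶ D
  c : p.R ⟶ H
  g : D ⟶ G
  h : D ⟶ H

/-- Both squares are pushouts of typed graphs and the match `m` is mono. -/
structure Diagram.IsDPO {T : Gph.{u}} {p : Rule T} {G H : TGph T} (t : Diagram p G H) :
    Prop where
  match_inj : Inj t.m
  left : IsPushout p.l t.d t.m t.g
  right : IsPushout p.r t.d t.c t.h

/-- There is a double-pushout transformation by `p` at the match `m`. -/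
def HasDPO {T : Gph.{u}} (p : Rule T) {G : TGph T} (m : p.L ⟶ G) : Prop :=
  ∃ (H : TGph T) (t : Diagram p G H), t.IsDPO ∧ t.m = m

/-- A (negative) constraint over a rule with left-hand side `L`: a mono `n : L ⟶ N`. -/
structure Constraint {T : Gph.{u}} (L : TGph T) : Type (u + 1) where
  N : TGph T
  n : L ⟶ N
  inj : Inj n

/-- `m ⊨ n`: there is no mono `q : N ⟶ G` with `q ∘ n = m`. -/
def Sat {T : Gph.{u}} {L G : TGph T} (m : L ⟶ G) (c : Constraint L) : Prop :=
  ¬ ∃ q : c.N ⟶ G, Inj q ∧ c.n ≫ q = m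

/-- `m` satisfies every constraint of a set. -/
def SatAll {T : Gph.{u}} {L G : TGph T} (m : L ⟶ G) (C : Set (Constraint L)) : Prop :=
  ∀ c ∈ C, Sat m c

/-- `c` subsumes `c'`: every match that satisfies `c` satisfies `c'`. -/
def Subsumes {T : Gph.{u}} {L : TGph T} (c c' : Constraint L) : Prop :=
  ∀ (G : TGph T) (m : L ⟶ G), Inj m → Sat m c → Sat m c'

/-- Incremental constraints: any two decompositions into monos are comparable. -/
def Incremental {T : Gph.{u}} {L : TGph T} (c : Constraint L) : Prop :=
  ∀ (X₁ X₂ : TGph T) (a₁ : L ⟶ X₁) (b₁ : X₁ ⟶ c.N) (a₂ : L ⟶ X₂) (b₂ : X₂ ⟶ c.N),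
    Inj a₁ → Inj b₁ → Inj a₂ → Inj b₂ → a₁ ≫ b₁ = c.n → a₂ ≫ b₂ = c.n →
    (∃ f : X₁ ⟶ X₂, a₁ ≫ f = a₂ ∧ f ≫ b₂ = b₁) ∨
    (∃ f : X₂ ⟶ X₁, a₂ ≫ f = a₁ ∧ f ≫ b₁ = b₂)

/-! ### Conditional graph grammars and derivations -/

/-- A conditional graph grammar: type graph, input graph, rule names, rules, and for each
rule name a negative application condition, that is, a set of constraints. -/
structure CGG : Type (max (u + 1) (v + 1)) where
  TG : Gph.{u}
  Gin : TGph TG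
  P : Type v
  rule : P → Rule TG
  nac : ∀ p, Set (Constraint (rule p).L)

/-- A conditional derivation of length `k`: a sequence of conditional transformations
starting from the input graph. -/
structure Derivation (C : CGG.{u, v}) (k : ℕ) : Type (max (u + 1) v) where
  G : Fin (k + 1) → TGph C.TG
  start : G 0 = C.Gin
  p : Fin k → C.P
  t : ∀ i : Fin k, Diagram (C.rule (p i)) (G i.castSucc) (G i.succ)
  dpo : ∀ i, (t i).IsDPO
  sat : ∀ i, SatAll (t i).m (C.nac (p i))

/-- `H` is the last graph of some conditional derivation. -/
def Reachable (C : CGG.{u, v}) (H : TGph C.TG) : Prop :=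
  ∃ (k : ℕ) (s : Derivation C k), s.G (Fin.last k) = H

/-- Safe grammars: the graphs of all rules and constraints, and all reachable graphs, have
an injective typing morphism. -/
structure Safe (C : CGG.{u, v}) : Prop where
  L_inj : ∀ p, Gph.Inj (C.rule p).L.hom
  K_inj : ∀ p, Gph.Inj (C.rule p).K.hom
  R_inj : ∀ p, Gph.Inj (C.rule p).R.hom
  N_inj : ∀ p, ∀ c ∈ C.nac p, Gph.Inj c.N.hom
  reachable_inj : ∀ G, Reachable C G → Gph.Inj G.hom

/-- Sequential independence of consecutive conditional transformations `t₁ : G ⇒ H₁` by `p₁`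
and `t₂ : H₁ ⇒ H₂` by `p₂`: there are `i : R₁ ⟶ D₂` and `j : L₂ ⟶ D₁` with `g₂ ∘ i = c₁` and
`h₁ ∘ j = m₂`, the match `g₁ ∘ j` of `p₂` in `G` satisfies the constraints of `p₂`, and, for the
transformation `t : G ⇒ H'` by `p₂` at this match, the match `L₁ ⟶ D ⟶ H'` of `p₁` that it
induces (`L₁ ⟶ D` being the factorization of `m₁` through `D ⟶ G`) satisfies the constraints
of `p₁`. -/
def SeqIndep (C : CGG.{u, v}) (p₁ p₂ : C.P) {G H₁ H₂ : TGph C.TG}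
    (t₁ : Diagram (C.rule p₁) G H₁) (t₂ : Diagram (C.rule p₂) H₁ H₂) : Prop :=
  ∃ (i : (C.rule p₁).R ⟶ t₂.D) (j : (C.rule p₂).L ⟶ t₁.D),
    i ≫ t₂.g = t₁.c ∧ j ≫ t₁.h = t₂.m ∧
    SatAll (j ≫ t₁.g) (C.nac p₂) ∧
    ∃ (H' : TGph C.TG) (t : Diagram (C.rule p₂) G H') (k : (C.rule p₁).L ⟶ t.D),
      t.IsDPO ∧ t.m = j ≫ t₁.g ∧ k ≫ t.g = t₁.m ∧ SatAll (k ≫ t.h) (C.nac p₁)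

/-! ### Morphisms of conditional grammars -/

/-- The pullback graph of `g : T₀ ⟶ T₁` and the typing of a `T₁`-typed graph. -/
def pullbackGph {T₀ T₁ : Gph.{u}} (g : T₀ ⟶ T₁) (X : TGph T₁) : Gph.{u} where
  N := {x : T₀.N × X.left.N // g.n x.1 = X.hom.n x.2}
  E := {x : T₀.E × X.left.E // g.e x.1 = X.hom.e x.2}
  s x := ⟨(T₀.s x.1.1, X.left.s x.1.2), by
    have h := X.hom.hs x.1.2
    rw [← x.2] at h
    exact (g.hs x.1.1).trans h.symm⟩
  t x := ⟨(T₀.t x.1.1, X.left.t x.1.2), by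
    have h := X.hom.ht x.1.2
    rw [← x.2] at h
    exact (g.ht x.1.1).trans h.symm⟩

/-- The pullback of a `T₁`-typed graph along `g : T₀ ⟶ T₁`, as a `T₀`-typed graph. -/
def pullbackObj {T₀ T₁ : Gph.{u}} (g : T₀ ⟶ T₁) (X : TGph T₁) : TGph T₀ :=
  Over.mk (Y := pullbackGph g X)
    (⟨fun x => x.1.1, fun x => x.1.1, fun _ => rfl, fun _ => rfl⟩ :
      Gph.Hom (pullbackGph g X) T₀)

/-- The action of pulling back on morphisms. -/
def pullbackMap {T₀ T₁ : Gph.{u}} (g : T₀ ⟶ T₁) {X Y : TGph T₁} (f : X ⟶ Y) :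
    pullbackGph g X ⟶ pullbackGph g Y :=
  ({ n := fun x => ⟨(x.1.1, f.left.n x.1.2),
      x.2.trans (congrArg (fun k : Gph.Hom _ _ => k.n x.1.2) (Over.w f)).symm⟩
     e := fun x => ⟨(x.1.1, f.left.e x.1.2),
      x.2.trans (congrArg (fun k : Gph.Hom _ _ => k.e x.1.2) (Over.w f)).symm⟩
     hs := fun x => Subtype.ext (Prod.ext rfl (f.left.hs x.1.2))
     ht := fun x => Subtype.ext (Prod.ext rfl (f.left.ht x.1.2)) } :
    Gph.Hom (pullbackGph g X) (pullbackGph g Y))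

/-- The pullback functor induced by `g : T₀ ⟶ T₁`. -/
def pullbackFunctor {T₀ T₁ : Gph.{u}} (g : T₀ ⟶ T₁) : TGph T₁ ⥤ TGph T₀ where
  obj := pullbackObj g
  map f := Over.homMk (U := pullbackObj g _) (V := pullbackObj g _) (pullbackMap g f) rfl
  map_id _ := rfl
  map_comp _ _ := rfl

/-- A span of type graphs. -/
structure TypeSpan (T₁ T₂ : Gph.{u}) : Type (u + 1) where
  T₀ : Gph.{u}
  left : T₀ ⟶ T₁
  right : T₀ ⟶ T₂

/-- The identity span. -/
def TypeSpan.id (T : Gph.{u}) : TypeSpan T T := ⟨T, 𝟙 T, 𝟙 T⟩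

/-- Retyping along a span: pull back along the left leg, then compose the typing with the
right leg. -/
def TypeSpan.retype {T₁ T₂ : Gph.{u}} (f : TypeSpan T₁ T₂) : TGph T₁ ⥤ TGph T₂ :=
  pullbackFunctor f.left ⋙ Over.map f.right

/-- A double-pushout diagram with mono vertical arrows that exhibits the rule `p'` as an
ancestor of the retyped rule `p`. -/
structure Ancestor {T₁ T₂ : Gph.{u}} (f : TypeSpan T₁ T₂) (p' : Rule T₂) (p : Rule T₁) :
    Type u where
  iL : p'.L ⟶ f.retype.obj p.L
  iK : p'.K ⟶ f.retype.obj p.K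
  iR : p'.R ⟶ f.retype.obj p.R
  iL_inj : Inj iL
  iK_inj : Inj iK
  iR_inj : Inj iR
  left : IsPushout p'.l iK iL (f.retype.map p.l)
  right : IsPushout p'.r iK iR (f.retype.map p.r)

/-- The pair of a span `f` of type graphs and a map `fP` of rule names is a morphism of
conditional grammars. -/
structure IsMorphism (C₁ C₂ : CGG.{u, v}) (f : TypeSpan C₁.TG C₂.TG) (fP : C₁.P → C₂.P) :
    Prop where
  left_inj : Gph.Inj f.left
  input : Nonempty (f.retype.obj C₁.Gin ≅ C₂.Gin)
  rules : ∀ p : C₁.P, ∃ a : Ancestor f (C₂.rule (fP p)) (C₁.rule p),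
    ∀ h : Constraint (C₁.rule p).L,
      (∃ n' ∈ C₂.nac (fP p), ∃ w : n'.N ⟶ f.retype.obj h.N,
        IsPushout n'.n a.iL w (f.retype.map h.n)) →
      ∃ n ∈ C₁.nac p, Subsumes n h

/-- The image of a transformation by `p` under a grammar morphism: the diagram that exhibits
`p'` as an ancestor of `p`, on top of the retyped transformation. -/
def Diagram.image {T₁ T₂ : Gph.{u}} {f : TypeSpan T₁ T₂} {p' : Rule T₂} {p : Rule T₁}
    {G H : TGph T₁} (a : Ancestor f p' p) (t : Diagram p G H) :
    Diagram p' (f.retype.obj G) (f.retype.obj H) where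
  D := f.retype.obj t.D
  m := a.iL ≫ f.retype.map t.m
  d := a.iK ≫ f.retype.map t.d
  c := a.iR ≫ f.retype.map t.c
  g := f.retype.map t.g
  h := f.retype.map t.h

/-- Every derivation of `C₁` is mapped to a derivation of `C₂`. -/
def PreservesDerivations (C₁ C₂ : CGG.{u, v}) (f : TypeSpan C₁.TG C₂.TG)
    (fP : C₁.P → C₂.P) : Prop :=
  ∀ (k : ℕ) (s : Derivation C₁ k), ∃ s' : Derivation C₂ k,
    (∀ i, s'.p i = fP (s.p i)) ∧ ∀ i, Nonempty (f.retype.obj (s.G i) ≅ s'.G i)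

/-- Every derivation of `C₂` is, up to isomorphism, the image of a derivation of `C₁`. -/
def ReflectsDerivations (C₁ C₂ : CGG.{u, v}) (f : TypeSpan C₁.TG C₂.TG)
    (fP : C₁.P → C₂.P) : Prop :=
  ∀ (k : ℕ) (s : Derivation C₂ k), ∃ s' : Derivation C₁ k,
    (∀ i, fP (s'.p i) = s.p i) ∧ ∀ i, Nonempty (f.retype.obj (s'.G i) ≅ s.G i)

/-- `G ⇒ H₁ ⇒ H₂` (by `p₁` and `p₂`) are consecutive conditional transformations of a
derivation of `C`. -/
structure Consecutive (C : CGG.{u, v}) (p₁ p₂ : C.P) {G H₁ H₂ : TGph C.TG}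
    (t₁ : Diagram (C.rule p₁) G H₁) (t₂ : Diagram (C.rule p₂) H₁ H₂) : Prop where
  reachable : Reachable C G
  dpo₁ : t₁.IsDPO
  sat₁ : SatAll t₁.m (C.nac p₁)
  dpo₂ : t₂.IsDPO
  sat₂ : SatAll t₂.m (C.nac p₂)

/-- Images of sequentially independent consecutive transformations are sequentially
independent. -/
def PreservesSeqIndep (C₁ C₂ : CGG.{u, v}) (f : TypeSpan C₁.TG C₂.TG)
    (fP : C₁.P → C₂.P) : Prop :=
  ∀ (p₁ p₂ : C₁.P) (G H₁ H₂ : TGph C₁.TG)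
    (t₁ : Diagram (C₁.rule p₁) G H₁) (t₂ : Diagram (C₁.rule p₂) H₁ H₂)
    (a₁ : Ancestor f (C₂.rule (fP p₁)) (C₁.rule p₁))
    (a₂ : Ancestor f (C₂.rule (fP p₂)) (C₁.rule p₂)),
    Consecutive C₁ p₁ p₂ t₁ t₂ → SeqIndep C₁ p₁ p₂ t₁ t₂ →
    SeqIndep C₂ (fP p₁) (fP p₂) (t₁.image a₁) (t₂.image a₂)

/-- Consecutive transformations whose images are sequentially independent are themselves
sequentially independent. -/
def ReflectsSeqIndep (C₁ C₂ : CGG.{u, v}) (f : TypeSpan C₁.TG C₂.TG)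
    (fP : C₁.P → C₂.P) : Prop :=
  ∀ (p₁ p₂ : C₁.P) (G H₁ H₂ : TGph C₁.TG)
    (t₁ : Diagram (C₁.rule p₁) G H₁) (t₂ : Diagram (C₁.rule p₂) H₁ H₂)
    (a₁ : Ancestor f (C₂.rule (fP p₁)) (C₁.rule p₁))
    (a₂ : Ancestor f (C₂.rule (fP p₂)) (C₁.rule p₂)),
    Consecutive C₁ p₁ p₂ t₁ t₂ →
    SeqIndep C₂ (fP p₁) (fP p₂) (t₁.image a₁) (t₂.image a₂) →
    SeqIndep C₁ p₁ p₂ t₁ t₂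

/-! ### Subgraphs

In a safe grammar all graphs occurring in rules and constraints are, via their typing,
subgraphs of the type graph; pullbacks over the type graph are intersections, and pushouts over
such pullbacks are unions. -/

/-- A subgraph of `T`. -/
@[ext]
structure Sub (T : Gph.{u}) : Type u where
  N : Set T.N
  E : Set T.E
  hs : ∀ e ∈ E, T.s e ∈ N
  ht : ∀ e ∈ E, T.t e ∈ N

namespace Sub

variable {T T' : Gph.{u}}

instance : PartialOrder (Sub T) where
  le A B := A.N ⊆ B.N ∧ A.E ⊆ B.E
  le_refl _ := ⟨subset_rfl, subset_rfl⟩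
  le_trans _ _ _ h k := ⟨h.1.trans k.1, h.2.trans k.2⟩
  le_antisymm _ _ h k := Sub.ext (h.1.antisymm k.1) (h.2.antisymm k.2)

/-- Union and intersection. -/
instance : Lattice (Sub T) where
  sup A B := ⟨A.N ∪ B.N, A.E ∪ B.E,
    fun e h => h.imp (A.hs e) (B.hs e), fun e h => h.imp (A.ht e) (B.ht e)⟩
  inf A B := ⟨A.N ∩ B.N, A.E ∩ B.E,
    fun e h => ⟨A.hs e h.1, B.hs e h.2⟩, fun e h => ⟨A.ht e h.1, B.ht e h.2⟩⟩
  le_sup_left _ _ := ⟨Set.subset_union_left, Set.subset_union_left⟩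
  le_sup_right _ _ := ⟨Set.subset_union_right, Set.subset_union_right⟩
  sup_le _ _ _ h k := ⟨Set.union_subset h.1 k.1, Set.union_subset h.2 k.2⟩
  inf_le_left _ _ := ⟨Set.inter_subset_left, Set.inter_subset_left⟩
  inf_le_right _ _ := ⟨Set.inter_subset_right, Set.inter_subset_right⟩
  le_inf _ _ _ h k := ⟨Set.subset_inter h.1 k.1, Set.subset_inter h.2 k.2⟩

/-- The union of a family of subgraphs. -/
def union {ι : Type*} (I : Set ι) (A : ι → Sub T) : Sub T where
  N := {v | ∃ i ∈ I, v ∈ (A i).N}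
  E := {e | ∃ i ∈ I, e ∈ (A i).E}
  hs := fun e ⟨i, hi, h⟩ => ⟨i, hi, (A i).hs e h⟩
  ht := fun e ⟨i, hi, h⟩ => ⟨i, hi, (A i).ht e h⟩

/-- The subgraph consisting of a set of nodes. -/
def nodes (S : Set T.N) : Sub T := ⟨S, ∅, fun _ h => h.elim, fun _ h => h.elim⟩

/-- The image of a subgraph under a morphism. -/
def map (f : T ⟶ T') (A : Sub T) : Sub T' where
  N := f.n '' A.N
  E := f.e '' A.E
  hs := by rintro _ ⟨e, he, rfl⟩; exact ⟨_, A.hs e he, f.hs e⟩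
  ht := by rintro _ ⟨e, he, rfl⟩; exact ⟨_, A.ht e he, f.ht e⟩

/-- The image of a morphism. -/
def range (f : T ⟶ T') : Sub T' := map f ⟨Set.univ, Set.univ, fun _ _ => trivial, fun _ _ => trivial⟩

/-- The image of the typing morphism of a typed graph. -/
def ofTyped (X : TGph T) : Sub T := range X.hom

theorem ofTyped_mono {X Y : TGph T} (f : X ⟶ Y) : ofTyped X ≤ ofTyped Y := by
  constructor
  · rintro _ ⟨x, -, rfl⟩
    exact ⟨f.left.n x, trivial, congrArg (fun k : Gph.Hom _ _ => k.n x) (Over.w f)⟩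
  · rintro _ ⟨x, -, rfl⟩
    exact ⟨f.left.e x, trivial, congrArg (fun k : Gph.Hom _ _ => k.e x) (Over.w f)⟩

theorem map_mono (f : T ⟶ T') {A B : Sub T} (h : A ≤ B) : map f A ≤ map f B :=
  ⟨Set.image_mono h.1, Set.image_mono h.2⟩

/-- The typed graph `A + S`: the subgraph `A` together with a disjoint copy of the nodes in
`S` (without arcs), typed by the inclusions. -/
def plus (A : Sub T) (S : Set T.N) : TGph T :=
  Over.mk (Y := (⟨A.N ⊕ S, A.E, fun e => Sum.inl ⟨T.s e, A.hs _ e.2⟩,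
      fun e => Sum.inl ⟨T.t e, A.ht _ e.2⟩⟩ : Gph.{u}))
    (⟨Sum.elim Subtype.val Subtype.val, Subtype.val, fun _ => rfl, fun _ => rfl⟩ : Gph.Hom _ _)

/-- A subgraph as a typed graph. -/
def typed (A : Sub T) : TGph T :=
  Over.mk (Y := (⟨A.N, A.E, fun e => ⟨T.s e, A.hs _ e.2⟩, fun e => ⟨T.t e, A.ht _ e.2⟩⟩ :
      Gph.{u}))
    (⟨Subtype.val, Subtype.val, fun _ => rfl, fun _ => rfl⟩ : Gph.Hom _ _)

/-- The inclusion of typed graphs induced by an inclusion of subgraphs. -/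
def incl {A B : Sub T} (h : A ≤ B) : A.typed ⟶ B.typed :=
  Over.homMk (⟨Set.inclusion h.1, Set.inclusion h.2, fun _ => rfl, fun _ => rfl⟩ :
    Gph.Hom _ _) rfl

theorem incl_inj {A B : Sub T} (h : A ≤ B) : Inj (incl h) :=
  ⟨Set.inclusion_injective h.1, Set.inclusion_injective h.2⟩

/-- The morphism `A + S ⟶ B + S` induced by an inclusion `A ≤ B`. -/
def plusIncl {A B : Sub T} (h : A ≤ B) (S : Set T.N) : A.plus S ⟶ B.plus S :=
  Over.homMk (⟨Sum.map (Set.inclusion h.1) id, Set.inclusion h.2, fun _ => rfl,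
      fun _ => rfl⟩ : Gph.Hom _ _)
    (by
      apply Gph.Hom.ext
      · funext x; rcases x with x | x <;> rfl
      · rfl)

theorem plusIncl_inj {A B : Sub T} (h : A ≤ B) (S : Set T.N) : Inj (plusIncl h S) :=
  ⟨(Set.inclusion_injective h.1).sumMap Function.injective_id, Set.inclusion_injective h.2⟩

/-- The morphism `A + S ⟶ B` for `A ≤ B` and `S` a set of nodes of `B`. -/
def plusDesc {A B : Sub T} (h : A ≤ B) {S : Set T.N} (hS : S ⊆ B.N) : A.plus S ⟶ B.typed :=
  Over.homMk (⟨Sum.elim (Set.inclusion h.1) (Set.inclusion hS), Set.inclusion h.2,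
      fun _ => rfl, fun _ => rfl⟩ : Gph.Hom _ _)
    (by
      apply Gph.Hom.ext
      · funext x; rcases x with x | x <;> rfl
      · rfl)

theorem plusDesc_inj {A B : Sub T} (h : A ≤ B) {S : Set T.N} (hS : S ⊆ B.N)
    (hd : Disjoint A.N S) : Inj (plusDesc h hS) := by
  refine ⟨?_, Set.inclusion_injective h.2⟩
  refine (Set.inclusion_injective h.1).sumElim (Set.inclusion_injective hS) ?_
  intro a b hab
  have h' : a.1 = b.1 := congrArg Subtype.val hab
  exact Set.disjoint_left.mp hd a.2 (h' ▸ b.2)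

end Sub

/-- A rule all of whose graphs are subgraphs of the type graph. -/
structure SubRule (T : Gph.{u}) : Type u where
  L : Sub T
  K : Sub T
  R : Sub T
  hL : K ≤ L
  hR : K ≤ R

/-- The span of inclusions. -/
def SubRule.toRule {T : Gph.{u}} (p : SubRule T) : Rule T where
  L := p.L.typed
  K := p.K.typed
  R := p.R.typed
  l := Sub.incl p.hL
  r := Sub.incl p.hR
  l_inj := Sub.incl_inj _
  r_inj := Sub.incl_inj _

/-! ### Shapes and the enriched type graph -/

/-- A shape, as a pair of subgraphs of the type graph: border and body. -/
structure Shape (T : Gph.{u}) : Type u where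
  border : Sub T
  body : Sub T
  le : border ≤ body

/-- The smallest subgraph of `N` containing the items that are not in the image of `L`. -/
def Constraint.negative {T : Gph.{u}} {L : TGph T} (c : Constraint L) : Sub c.N.left where
  N := {v | v ∉ Set.range c.n.left.n ∨
    ∃ e, e ∉ Set.range c.n.left.e ∧ (v = c.N.left.s e ∨ v = c.N.left.t e)}
  E := {e | e ∉ Set.range c.n.left.e}
  hs := fun e he => Or.inr ⟨e, he, Or.inl rfl⟩
  ht := fun e he => Or.inr ⟨e, he, Or.inr rfl⟩

/-- The shape of a constraint: the body is the subgraph of negative items and the border is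
the part of it that lies in the image of `L`. -/
def Constraint.shape {T : Gph.{u}} {L : TGph T} (c : Constraint L) : Shape T where
  border := (c.negative ⊓ Sub.range c.n.left).map c.N.hom
  body := c.negative.map c.N.hom
  le := Sub.map_mono _ inf_le_left

/-- Shape `E`: the border consists of two distinct nodes and the body has one additional arc,
from one of them to the other. -/
def Shape.IsE {T : Gph.{u}} (σ : Shape T) : Prop :=
  ∃ e : T.E, T.s e ≠ T.t e ∧ σ.border = Sub.nodes {T.s e, T.t e} ∧
    σ.body.N = {T.s e, T.t e} ∧ σ.body.E = {e}

/-- The shapes of the constraints of a rule. -/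
def ruleShapes (C : CGG.{u, v}) (p : C.P) : Set (Shape C.TG) :=
  {σ | ∃ c ∈ C.nac p, σ = c.shape}

/-- The shapes of the constraints of the grammar. -/
def shapes (C : CGG.{u, v}) : Set (Shape C.TG) := {σ | ∃ p, σ ∈ ruleShapes C p}

section Enriched

open Classical in
/-- The node of the enriched type graph to which a node `v` of the body of `σ` is sent by the
complemented typing: `v` itself on the border, and a new node otherwise. -/
noncomputable def barN {T : Gph.{u}} {S : Set (Shape T)} (σ : S) (v : σ.1.body.N) :
    T.N ⊕ (Σ σ : S, {v : T.N // v ∈ σ.1.body.N ∧ v ∉ σ.1.border.N}) :=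
  if h : v.1 ∈ σ.1.border.N then Sum.inl v.1 else Sum.inr ⟨σ, v.1, v.2, h⟩

open Classical in
/-- The same for arcs. -/
noncomputable def barE {T : Gph.{u}} {S : Set (Shape T)} (σ : S) (e : σ.1.body.E) :
    T.E ⊕ (Σ σ : S, {e : T.E // e ∈ σ.1.body.E ∧ e ∉ σ.1.border.E}) :=
  if h : e.1 ∈ σ.1.border.E then Sum.inl e.1 else Sum.inr ⟨σ, e.1, e.2, h⟩

/-- The colimit of `T` and of all the shapes `border ⟶ body` in `S`, glued along the typings
`border ⟶ T`: it adds to `T`, for each shape, a copy of the items of the body that are not in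
the border. -/
noncomputable def enrich (T : Gph.{u}) (S : Set (Shape T)) : Gph.{u} where
  N := T.N ⊕ (Σ σ : S, {v : T.N // v ∈ σ.1.body.N ∧ v ∉ σ.1.border.N})
  E := T.E ⊕ (Σ σ : S, {e : T.E // e ∈ σ.1.body.E ∧ e ∉ σ.1.border.E})
  s := Sum.elim (fun e => Sum.inl (T.s e))
    (fun x => barN x.1 ⟨T.s x.2.1, x.1.1.body.hs _ x.2.2.1⟩)
  t := Sum.elim (fun e => Sum.inl (T.t e))
    (fun x => barN x.1 ⟨T.t x.2.1, x.1.1.body.ht _ x.2.2.1⟩)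

/-- The inclusion of the type graph in the enriched type graph. -/
noncomputable def enrichIn (T : Gph.{u}) (S : Set (Shape T)) : T ⟶ enrich T S :=
  (⟨Sum.inl, Sum.inl, fun _ => rfl, fun _ => rfl⟩ : Gph.Hom _ _)

/-- The complement of the body of a shape, as a subgraph of the enriched type graph. It
contains the border. -/
noncomputable def complement {T : Gph.{u}} {S : Set (Shape T)} (σ : S) : Sub (enrich T S) where
  N := Set.range (barN σ)
  E := Set.range (barE σ)
  hs := by
    rintro _ ⟨e, rfl⟩
    refine ⟨⟨T.s e.1, σ.1.body.hs _ e.2⟩, ?_⟩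
    by_cases h : e.1 ∈ σ.1.border.E
    · simp [barE, enrich, h, barN, σ.1.border.hs _ h]
    · simp [barE, enrich, h]
  ht := by
    rintro _ ⟨e, rfl⟩
    refine ⟨⟨T.t e.1, σ.1.body.ht _ e.2⟩, ?_⟩
    by_cases h : e.1 ∈ σ.1.border.E
    · simp [barE, enrich, h, barN, σ.1.border.ht _ h]
    · simp [barE, enrich, h]

variable (C : CGG.{u, v})

/-- The enriched type graph of a grammar. -/
noncomputable abbrev TGbar : Gph.{u} := enrich C.TG (shapes C)

/-- The inclusion of the original type graph in the enriched one. -/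
noncomputable abbrev inTG : C.TG ⟶ TGbar C := enrichIn C.TG (shapes C)

/-- A typed graph of the original grammar (with injective typing), as a subgraph of the
enriched type graph. -/
noncomputable def asSub (X : TGph C.TG) : Sub (TGbar C) := (Sub.ofTyped X).map (inTG C)

/-- The border of a shape in the enriched type graph. -/
noncomputable def borderIn (σ : shapes C) : Sub (TGbar C) := σ.1.border.map (inTG C)

/-- The (uncomplemented) body of a shape in the enriched type graph. -/
noncomputable def bodyIn (σ : shapes C) : Sub (TGbar C) := σ.1.body.map (inTG C)

/-- The invariant closure of a graph `G` over `TG`: the complement of the body of a shape is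
added if and only if the border is contained in `G` but the body is not. -/
noncomputable def invClosure (G : TGph C.TG) : Sub (TGbar C) :=
  asSub C G ⊔ Sub.union {σ : shapes C | borderIn C σ ≤ asSub C G ∧ ¬ bodyIn C σ ≤ asSub C G}
    complement

/-! ### Complemented rules -/

variable {C} in
/-- A rule of the grammar, over the enriched type graph. -/
noncomputable def baseRule (p : C.P) : SubRule (TGbar C) where
  L := asSub C (C.rule p).L
  K := asSub C (C.rule p).K
  R := asSub C (C.rule p).R
  hL := Sub.map_mono _ (Sub.ofTyped_mono (C.rule p).l)
  hR := Sub.map_mono _ (Sub.ofTyped_mono (C.rule p).r)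

variable {C} in
/-- The shapes of the constraints of `p`, as shapes of the grammar. -/
def ownShapes (p : C.P) : Set (shapes C) := {σ | σ.1 ∈ ruleShapes C p}

variable {C} in
/-- The shapes of the grammar that are not shapes of constraints of `p`. -/
def otherShapes (p : C.P) : Set (shapes C) := {σ | σ.1 ∉ ruleShapes C p}

variable {C} in
/-- The complement of the body of the shape `σ` is preserved by the complemented rule: the rule
can be applied to the complemented constraint `L ⟶ L ⊔ complement σ`, and there is no arrow from
the body to the right-hand side. -/
def KeepsComplement (p : C.P) (σ : shapes C) : Prop :=
  HasDPO (baseRule p).toRule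
      (Sub.incl (le_sup_left : (baseRule p).L ≤ (baseRule p).L ⊔ complement σ)) ∧
    ¬ bodyIn C σ ≤ (baseRule p).R

variable {C} in
/-- The complementation of a rule. All constraints are treated at once: complements of distinct
shapes have only items of `TG` in common, so that the treatment of one constraint affects neither
the condition nor the effect of the treatment of another. If `KeepsComplement p σ`, the rule is
replaced by the derived rule, whose left-hand side, interface and right-hand side contain the
complement in addition; otherwise only the left-hand side is extended. -/
noncomputable def complRule (p : C.P) : SubRule (TGbar C) where
  L := (baseRule p).L ⊔ Sub.union (ownShapes p) complement
  K := (baseRule p).K ⊔ Sub.union {σ ∈ ownShapes p | KeepsComplement p σ} complement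
  R := (baseRule p).R ⊔ Sub.union {σ ∈ ownShapes p | KeepsComplement p σ} complement
  hL := sup_le_sup (baseRule p).hL
    ⟨fun _ ⟨σ, h, k⟩ => ⟨σ, h.1, k⟩, fun _ ⟨σ, h, k⟩ => ⟨σ, h.1, k⟩⟩
  hR := sup_le_sup_right (baseRule p).hR _

/-! ### Making the rules invariant-preserving -/

variable {C} in
/-- Compensate body deletion: if the body of a shape is contained in the left-hand side and is
not preserved, but its border is, then its complement is created. -/
noncomputable def step1 (p : C.P) : SubRule (TGbar C) where
  L := (complRule p).L
  K := (complRule p).K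
  R := (complRule p).R ⊔ Sub.union {σ ∈ otherShapes p | bodyIn C σ ≤ (complRule p).L ∧
    ¬ bodyIn C σ ≤ (complRule p).K ∧ borderIn C σ ≤ (complRule p).K} complement
  hL := (complRule p).hL
  hR := (complRule p).hR.trans le_sup_left

variable {C} in
/-- Compensate body creation: if the body of a shape is contained in the right-hand side and is
not preserved, but its border is, then its complement is deleted. -/
noncomputable def step2 (p : C.P) : SubRule (TGbar C) where
  L := (step1 p).L ⊔ Sub.union {σ ∈ otherShapes p | bodyIn C σ ≤ (step1 p).R ∧
    ¬ bodyIn C σ ≤ (step1 p).K ∧ borderIn C σ ≤ (step1 p).K} complement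
  K := (step1 p).K
  R := (step1 p).R
  hL := (step1 p).hL.trans le_sup_left
  hR := (step1 p).hR

variable {C} in
/-- Complete border creation: if the border of a shape is contained in the right-hand side and
is not preserved, and the body is not contained in the right-hand side, then the complement of
the body is created. -/
noncomputable def step3 (p : C.P) : SubRule (TGbar C) where
  L := (step2 p).L
  K := (step2 p).K
  R := (step2 p).R ⊔ Sub.union {σ ∈ otherShapes p | borderIn C σ ≤ (step2 p).R ∧
    ¬ borderIn C σ ≤ (step2 p).K ∧ ¬ bodyIn C σ ≤ (step2 p).R} complement
  hL := (step2 p).hL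
  hR := (step2 p).hR.trans le_sup_left

variable {C} in
/-- The nodes that are added to the rule when its partial border creations are completed for the
shapes in `Z`: the nodes of the borders that are not in the right-hand side. -/
def addedNodes (p : C.P) (Z : Set (shapes C)) : Set (TGbar C).N :=
  {v | ∃ σ ∈ Z, v ∈ (borderIn C σ).N ∧ v ∉ (step3 p).R.N}

variable {C} in
/-- The right-hand side after the completion for the shapes in `Z` (it contains the borders of
the shapes in `Z`, hence the added nodes). -/
noncomputable def finalR (p : C.P) (Z : Set (shapes C)) : Sub (TGbar C) :=
  (step3 p).R ⊔ Sub.union Z complement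

variable {C} in
/-- The interface after the completion for the shapes in `Z`, as a subgraph. -/
noncomputable def finalK (p : C.P) (Z : Set (shapes C)) : Sub (TGbar C) :=
  (step3 p).K ⊔ Sub.nodes (addedNodes p Z)

variable {C} in
/-- Complete partial border creation: `Completion p Z` says that the procedure produces from the
rule `p` a rule in which partial border creation has been completed exactly for the shapes in
`Z`. The procedure starts with the rule itself. A rule it has produced is extended by a shape of
type `E` if its right-hand side does not contain the border, but contains a part of it that is
not contained in its interface (the rule creates part of the border, but not all of it). -/
inductive Completion (p : C.P) : Set (shapes C) → Prop
  | start : Completion p ∅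
  | extend (Z : Set (shapes C)) (σ : shapes C) : Completion p Z → σ ∈ otherShapes p →
      σ.1.IsE → ¬ borderIn C σ ≤ finalR p Z →
      finalK p Z ⊓ borderIn C σ ≠ finalR p Z ⊓ borderIn C σ →
      Completion p (insert σ Z)

variable {C} in
theorem addedNodes_subset (p : C.P) (Z : Set (shapes C)) :
    addedNodes p Z ⊆ (finalR p Z).N := by
  rintro _ ⟨σ, hσ, ⟨v, hv, rfl⟩, -⟩
  refine Or.inr ⟨σ, hσ, ⟨v, σ.1.le.1 hv⟩, ?_⟩
  simp [barN, hv]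
  rfl

variable {C} in
theorem disjoint_addedNodes (p : C.P) (Z : Set (shapes C)) :
    Disjoint (step3 p).K.N (addedNodes p Z) :=
  Set.disjoint_left.mpr fun _ hv ⟨_, _, _, h⟩ => h ((step3 p).hR.1 hv)

variable {C} in
/-- The rule produced from `p` for the shapes in `Z`. Left-hand side and interface are extended by
pushouts, so the added nodes are disjoint from the graphs that are extended. -/
noncomputable def finalRule (p : C.P) (Z : Set (shapes C)) : Rule (TGbar C) where
  L := (step3 p).L.plus (addedNodes p Z)
  K := (step3 p).K.plus (addedNodes p Z)
  R := (finalR p Z).typed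
  l := Sub.plusIncl (step3 p).hL _
  r := Sub.plusDesc ((step3 p).hR.trans le_sup_left) (addedNodes_subset p Z)
  l_inj := Sub.plusIncl_inj _ _
  r_inj := Sub.plusDesc_inj _ _ (disjoint_addedNodes p Z)

variable {C} in
/-- A constraint of `p`, lifted along all extensions of the left-hand side of `p` (that is,
pushed out along the inclusion of the original left-hand side in the final one). -/
noncomputable def finalConstraint (p : C.P) (Z : Set (shapes C))
    (c : Constraint (C.rule p).L) : Constraint (finalRule p Z).L where
  N := (asSub C c.N ⊔ (step3 p).L).plus (addedNodes p Z)
  n := Sub.plusIncl le_sup_right _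
  inj := Sub.plusIncl_inj _ _

/-- The enriched grammar `E(C)` of a safe grammar `C` with incremental constraints. -/
noncomputable def enrichedGrammar : CGG.{u, max u v} where
  TG := TGbar C
  Gin := (invClosure C C.Gin).typed
  P := Σ p : C.P, {Z : Set (shapes C) // Completion p Z}
  rule q := finalRule q.1 q.2.1
  nac q := finalConstraint q.1 q.2.1 '' C.nac q.1

end Enriched

/-- The grammar obtained by deleting all negative application conditions. -/
def CGG.dropNACs (C : CGG.{u, v}) : CGG.{u, v} where
  TG := C.TG
  Gin := C.Gin
  P := C.P
  rule := C.rule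
  nac _ := ∅

end GraphGrammar

/-!
Every graph `H` derived by the rules of the enriched grammar, with their constraints ignored, has
the following property (`Invariant`): the part of `H` that is typed in the original type graph is
reachable in the original grammar, and the complement of a shape occurs at most once in `H`, and
only if the body of the shape does not occur in `H`. The left-hand side of every rule contains the
complements of the shapes of its own constraints, so that a graph with this property that contains
the left-hand side cannot contain the body of such a constraint: every match in it satisfies the
constraints (`Invariant.satAll`). Hence the constraints may be deleted, and all parts of the theorem
follow. In particular, the matches that arise when two independent transformations are exchanged
satisfy the constraints because they are matches in graphs that have the property.

The property is preserved by a transformation `G ⇒ H` for two reasons.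

* The transformation restricts to a transformation by the original rule
  (`ElementwiseDPO.restrict`), whose match satisfies the original constraints by the argument above.
  So the original part of `H` is reachable, and since the grammar is safe, it is typed
  injectively.
* An incremental constraint that is not an isomorphism forbids a single arc, perhaps together with
  end nodes of it, or a single isolated node (`Incremental.shape_cases`). It therefore suffices to
  follow one item of the body and the corresponding item of the complement
  (`Exclusive.of_setPO`). If the body is created, then either the complement has been deleted along
  with it, or a border node has been created as well. If the complement is created, then either
  the body has been deleted, or a border node has been created. A created border node excludes
  preserved arcs at a node of the same type, because the original part of `H` is typed injectively
  (`ElementwiseDPO.not_preserved_of_created`).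

Whether complements are present whenever they could be does not matter: only the implication from
the presence of a complement to the absence of the body is used.

For the comparison with images along the identity span, one needs that a rule is an ancestor of
itself in only one way (`Ancestor.iL_eq`, `Ancestor.iR_eq`); this holds although the left-hand
sides may contain two nodes of the same type.
-/

namespace GraphGrammar

/-! ### Pushouts of typed graphs, elementwise -/

/-- A square of functions that is a pushout of sets along injections: the lower maps are injective,
jointly surjective, and their images meet only in the image of the upper left corner. -/
structure SetPO {A B C D : Type u} (f : A → B) (g : A → C) (h : B → D) (k : C → D) : Prop where
  comm : ∀ a, h (f a) = k (g a)
  inl_inj : Function.Injective h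
  inr_inj : Function.Injective k
  surj : ∀ d, (∃ b, h b = d) ∨ ∃ c, k c = d
  pull : ∀ b c, h b = k c → ∃ a, f a = b ∧ g a = c

open Classical in
/-- A square of functions with the universal property of a pushout, starting from injections, is
elementwise a pushout. -/
theorem SetPO.of_universal {A B C D : Type u} {f : A → B} {g : A → C} {h : B → D} {k : C → D}
    (hf : Function.Injective f) (hg : Function.Injective g) (comm : ∀ a, h (f a) = k (g a))
    (desc : ∀ (X : Type u) (a : B → X) (b : C → X), (∀ x, a (f x) = b (g x)) →
      ∃ c : D → X, (∀ x, c (h x) = a x) ∧ ∀ x, c (k x) = b x)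
    (uniq : ∀ (X : Type u) (a b : D → X), (∀ x, a (h x) = b (h x)) → (∀ x, a (k x) = b (k x)) →
      a = b) : SetPO f g h k := by
  -- the concrete pushout `B ⊔ (C \ g A)` serves as test object
  let β : C → B ⊕ {c : C // ¬ ∃ a, g a = c} := fun c =>
    if hc : ∃ a, g a = c then Sum.inl (f hc.choose) else Sum.inr ⟨c, hc⟩
  have hβ : ∀ a, β (g a) = Sum.inl (f a) := fun a => by
    have hc : ∃ a', g a' = g a := ⟨a, rfl⟩
    simp only [β, dif_pos hc]
    rw [hg hc.choose_spec]
  have hβ' : ∀ b c, Sum.inl b = β c → ∃ a, f a = b ∧ g a = c := fun b c e => by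
    by_cases hc : ∃ a, g a = c
    · obtain ⟨a, rfl⟩ := hc
      rw [hβ] at e
      exact ⟨a, (Sum.inl.inj e).symm, rfl⟩
    · simp [β, dif_neg hc] at e
  have hβi : Function.Injective β := fun c c' e => by
    by_cases hc : ∃ a, g a = c
    · obtain ⟨a, rfl⟩ := hc
      rw [hβ] at e
      obtain ⟨a', h₁, rfl⟩ := hβ' _ _ e
      rw [hf h₁]
    · by_cases hc' : ∃ a, g a = c'
      · obtain ⟨a, rfl⟩ := hc'
        rw [hβ] at e
        obtain ⟨a', h₁, rfl⟩ := hβ' _ _ e.symm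
        rw [hf h₁]
      · simpa [β, dif_neg hc, dif_neg hc'] using e
  obtain ⟨φ, h₁, h₂⟩ := desc _ Sum.inl β fun x => (hβ x).symm
  refine ⟨comm, fun x y e => ?_, fun x y e => ?_, ?_, fun b c e => ?_⟩
  · exact Sum.inl.inj ((h₁ x).symm.trans ((congrArg φ e).trans (h₁ y)))
  · exact hβi ((h₂ x).symm.trans ((congrArg φ e).trans (h₂ y)))
  · have := uniq (ULift.{u} Prop) (fun d => ⟨(∃ b, h b = d) ∨ ∃ c, k c = d⟩) (fun _ => ⟨True⟩)
      (fun x => by simp) (fun x => by simp)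
    intro d
    simpa using congrArg ULift.down (congrFun this d)
  · exact hβ' b c ((h₁ b).symm.trans ((congrArg φ e).trans (h₂ c)))

theorem SetPO.exists_desc {A B C D : Type u} {f : A → B} {g : A → C} {h : B → D} {k : C → D}
    (H : SetPO f g h k) {X : Type u} (a : B → X) (b : C → X) (e : ∀ x, a (f x) = b (g x)) :
    ∃ c : D → X, (∀ x, c (h x) = a x) ∧ ∀ x, c (k x) = b x := by
  classical
  refine ⟨fun d => if hd : ∃ x, h x = d then a hd.choose else
    b ((H.surj d).resolve_left hd).choose, fun x => ?_, fun x => ?_⟩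
  · have hd : ∃ x', h x' = h x := ⟨x, rfl⟩
    simp only [dif_pos hd]
    rw [H.inl_inj hd.choose_spec]
  · by_cases hd : ∃ x', h x' = k x
    · simp only [dif_pos hd]
      obtain ⟨y, h₁, h₂⟩ := H.pull _ _ hd.choose_spec
      rw [← h₁, e, h₂]
    · simp only [dif_neg hd]
      rw [H.inr_inj ((H.surj (k x)).resolve_left hd).choose_spec]

namespace Gph

theorem hom_n_congr {A B : Gph.{u}} {f g : A ⟶ B} (h : f = g) (x : A.N) : f.n x = g.n x := by
  rw [h]

theorem hom_e_congr {A B : Gph.{u}} {f g : A ⟶ B} (h : f = g) (x : A.E) : f.e x = g.e x := by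
  rw [h]

theorem hom_ext' {A B : Gph.{u}} {f g : A ⟶ B} (hn : ∀ x, f.n x = g.n x)
    (he : ∀ x, f.e x = g.e x) : f = g :=
  Gph.Hom.ext (funext hn) (funext he)

end Gph

section Typed

variable {T : Gph.{u}}

theorem typed_n {A B : TGph T} (f : A ⟶ B) (x : A.left.N) :
    B.hom.n (f.left.n x) = A.hom.n x := Gph.hom_n_congr (Over.w f) x

theorem typed_e {A B : TGph T} (f : A ⟶ B) (x : A.left.E) :
    B.hom.e (f.left.e x) = A.hom.e x := Gph.hom_e_congr (Over.w f) x

theorem tgph_ext {A B : TGph T} {f g : A ⟶ B} (hn : ∀ x, f.left.n x = g.left.n x)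
    (he : ∀ x, f.left.e x = g.left.e x) : f = g :=
  Over.OverMorphism.ext (Gph.hom_ext' hn he)

/-- A morphism of typed graphs from its components. -/
def mkHom {A B : TGph T} (n : A.left.N → B.left.N) (e : A.left.E → B.left.E)
    (hs : ∀ x, n (A.left.s x) = B.left.s (e x)) (ht : ∀ x, n (A.left.t x) = B.left.t (e x))
    (hn : ∀ x, B.hom.n (n x) = A.hom.n x) (he : ∀ x, B.hom.e (e x) = A.hom.e x) : A ⟶ B :=
  Over.homMk (⟨n, e, hs, ht⟩ : Gph.Hom _ _) (Gph.hom_ext' hn he)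

/-- Two morphisms into an injectively typed graph are equal. -/
theorem eq_of_injective_typing {A B : TGph T} (hB : Gph.Inj B.hom) (f g : A ⟶ B) : f = g :=
  tgph_ext (fun x => hB.1 ((typed_n f x).trans (typed_n g x).symm))
    (fun x => hB.2 ((typed_e f x).trans (typed_e g x).symm))

theorem Inj.comp {A B D : TGph T} {f : A ⟶ B} {g : B ⟶ D} (hf : Inj f) (hg : Inj g) :
    Inj (f ≫ g) := ⟨hg.1.comp hf.1, hg.2.comp hf.2⟩

theorem Inj.of_iso {A B : TGph T} (e : A ≅ B) : Inj e.hom :=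
  ⟨fun x y h => by
    have hx := Gph.hom_n_congr (congrArg CommaMorphism.left e.hom_inv_id)
    have h' := congrArg e.inv.left.n h
    exact (hx x).symm.trans (h'.trans (hx y)),
   fun x y h => by
    have hx := Gph.hom_e_congr (congrArg CommaMorphism.left e.hom_inv_id)
    have h' := congrArg e.inv.left.e h
    exact (hx x).symm.trans (h'.trans (hx y))⟩

/-- A bijective morphism of typed graphs is an isomorphism. -/
theorem nonempty_iso_of_bij {A B : TGph T} (f : A ⟶ B) (hf : Gph.Bij f.left) :
    Nonempty (A ≅ B) := by
  obtain ⟨n, hn₁, hn₂⟩ := Function.bijective_iff_has_inverse.mp hf.1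
  obtain ⟨e, he₁, he₂⟩ := Function.bijective_iff_has_inverse.mp hf.2
  refine ⟨⟨f, mkHom n e (fun x => ?_) (fun x => ?_) (fun x => ?_) (fun x => ?_),
    tgph_ext hn₁ he₁, tgph_ext hn₂ he₂⟩⟩
  · apply hf.1.1
    rw [hn₂, f.left.hs, he₂]
  · apply hf.1.1
    rw [hn₂, f.left.ht, he₂]
  · rw [← typed_n f, hn₂]
  · rw [← typed_e f, he₂]

/-- The `T`-typed graph with node set `T.N × X` that is codiscrete relative to `T`: morphisms into
it are functions from nodes to `X`. -/
def codiscrete (T : Gph.{u}) (X : Type u) : TGph T :=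
  Over.mk (Y := (⟨T.N × X, T.E × X × X, fun a => (T.s a.1, a.2.1), fun a => (T.t a.1, a.2.2)⟩ :
    Gph.{u})) (⟨Prod.fst, Prod.fst, fun _ => rfl, fun _ => rfl⟩ : Gph.Hom _ _)

/-- The morphism into `codiscrete T X` given by a function on nodes. -/
def toCodiscrete {A : TGph T} {X : Type u} (a : A.left.N → X) : A ⟶ codiscrete T X :=
  mkHom (fun x => (A.hom.n x, a x)) (fun x => (A.hom.e x, a (A.left.s x), a (A.left.t x)))
    (fun x => Prod.ext (A.hom.hs x) rfl) (fun x => Prod.ext (A.hom.ht x) rfl)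
    (fun _ => rfl) (fun _ => rfl)

/-- The `T`-typed graph whose arcs carry a label from `X`: morphisms into it are functions from
arcs to `X`. -/
def arcLabelled (T : Gph.{u}) (X : Type u) : TGph T :=
  Over.mk (Y := (⟨T.N, T.E × X, fun a => T.s a.1, fun a => T.t a.1⟩ : Gph.{u}))
    (⟨id, Prod.fst, fun _ => rfl, fun _ => rfl⟩ :
      Gph.Hom (⟨T.N, T.E × X, fun a => T.s a.1, fun a => T.t a.1⟩ : Gph.{u}) T)

/-- The morphism into `arcLabelled T X` given by a function on arcs. -/
def toArcLabelled {A : TGph T} {X : Type u} (a : A.left.E → X) : A ⟶ arcLabelled T X :=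
  mkHom (fun x => A.hom.n x) (fun x => (A.hom.e x, a x))
    (fun x => A.hom.hs x) (fun x => A.hom.ht x)
    (fun _ => rfl) (fun _ => rfl)

/-- The universal property of a pushout of typed graphs, applied to codiscrete graphs, gives the
universal property of the square of node sets. -/
theorem setPO_n {A B D G : TGph T} {f : A ⟶ B} {g : A ⟶ D} {h : B ⟶ G} {k : D ⟶ G}
    (H : IsPushout f g h k) (hf : Inj f) (hg : Inj g) :
    SetPO f.left.n g.left.n h.left.n k.left.n := by
  refine SetPO.of_universal hf.1 hg.1
    (Gph.hom_n_congr (congrArg CommaMorphism.left H.w)) (fun X a b e => ?_)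
    (fun X a b h₁ h₂ => ?_)
  · have w : f ≫ toCodiscrete a = g ≫ toCodiscrete b := by
      apply tgph_ext
      · intro x
        exact Prod.ext ((typed_n f x).trans (typed_n g x).symm) (e x)
      · intro x
        refine Prod.ext ((typed_e f x).trans (typed_e g x).symm) (Prod.ext ?_ ?_)
        · change a (B.left.s (f.left.e x)) = b (D.left.s (g.left.e x))
          rw [← f.left.hs, ← g.left.hs, e]
        · change a (B.left.t (f.left.e x)) = b (D.left.t (g.left.e x))
          rw [← f.left.ht, ← g.left.ht, e]
    refine ⟨fun x => ((H.desc _ _ w).left.n x).2, fun x => ?_, fun x => ?_⟩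
    · exact congrArg Prod.snd
        (Gph.hom_n_congr (congrArg CommaMorphism.left (H.inl_desc _ _ w)) x)
    · exact congrArg Prod.snd
        (Gph.hom_n_congr (congrArg CommaMorphism.left (H.inr_desc _ _ w)) x)
  · have : toCodiscrete a = toCodiscrete b := by
      apply H.hom_ext
      · apply tgph_ext
        · intro x
          exact Prod.ext rfl (h₁ x)
        · intro x
          refine Prod.ext rfl (Prod.ext ?_ ?_)
          · change a (G.left.s (h.left.e x)) = b (G.left.s (h.left.e x))
            rw [← h.left.hs, h₁]
          · change a (G.left.t (h.left.e x)) = b (G.left.t (h.left.e x))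
            rw [← h.left.ht, h₁]
      · apply tgph_ext
        · intro x
          exact Prod.ext rfl (h₂ x)
        · intro x
          refine Prod.ext rfl (Prod.ext ?_ ?_)
          · change a (G.left.s (k.left.e x)) = b (G.left.s (k.left.e x))
            rw [← k.left.hs, h₂]
          · change a (G.left.t (k.left.e x)) = b (G.left.t (k.left.e x))
            rw [← k.left.ht, h₂]
    funext x
    exact congrArg Prod.snd (Gph.hom_n_congr (congrArg CommaMorphism.left this) x)

/-- The same for arc sets, with the graphs of labelled arcs. -/
theorem setPO_e {A B D G : TGph T} {f : A ⟶ B} {g : A ⟶ D} {h : B ⟶ G} {k : D ⟶ G}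
    (H : IsPushout f g h k) (hf : Inj f) (hg : Inj g) :
    SetPO f.left.e g.left.e h.left.e k.left.e := by
  refine SetPO.of_universal hf.2 hg.2
    (Gph.hom_e_congr (congrArg CommaMorphism.left H.w)) (fun X a b e => ?_)
    (fun X a b h₁ h₂ => ?_)
  · have w : f ≫ toArcLabelled a = g ≫ toArcLabelled b :=
      tgph_ext (fun x => (typed_n f x).trans (typed_n g x).symm)
        (fun x => Prod.ext ((typed_e f x).trans (typed_e g x).symm) (e x))
    refine ⟨fun x => ((H.desc _ _ w).left.e x).2, fun x => ?_, fun x => ?_⟩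
    · exact congrArg Prod.snd
        (Gph.hom_e_congr (congrArg CommaMorphism.left (H.inl_desc _ _ w)) x)
    · exact congrArg Prod.snd
        (Gph.hom_e_congr (congrArg CommaMorphism.left (H.inr_desc _ _ w)) x)
  · have : toArcLabelled a = toArcLabelled b :=
      H.hom_ext (tgph_ext (fun _ => rfl) fun x => Prod.ext rfl (h₁ x))
        (tgph_ext (fun _ => rfl) fun x => Prod.ext rfl (h₂ x))
    funext x
    exact congrArg Prod.snd (Gph.hom_e_congr (congrArg CommaMorphism.left this) x)

theorem isPushout_of_setPO {A B D G : TGph T} {f : A ⟶ B} {g : A ⟶ D} {h : B ⟶ G} {k : D ⟶ G}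
    (hn : SetPO f.left.n g.left.n h.left.n k.left.n)
    (he : SetPO f.left.e g.left.e h.left.e k.left.e) : IsPushout f g h k := by
  have huniq : ∀ {X : TGph T} (a b : G ⟶ X), h ≫ a = h ≫ b → k ≫ a = k ≫ b → a = b := by
    intro X a b h₁ h₂
    apply tgph_ext
    · intro x
      rcases hn.surj x with ⟨y, rfl⟩ | ⟨y, rfl⟩
      · exact Gph.hom_n_congr (congrArg CommaMorphism.left h₁) y
      · exact Gph.hom_n_congr (congrArg CommaMorphism.left h₂) y
    · intro x
      rcases he.surj x with ⟨y, rfl⟩ | ⟨y, rfl⟩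
      · exact Gph.hom_e_congr (congrArg CommaMorphism.left h₁) y
      · exact Gph.hom_e_congr (congrArg CommaMorphism.left h₂) y
  have hdesc : ∀ {X : TGph T} (a : B ⟶ X) (b : D ⟶ X), f ≫ a = g ≫ b →
      ∃ c : G ⟶ X, h ≫ c = a ∧ k ≫ c = b := by
    intro X a b w
    obtain ⟨n, n₁, n₂⟩ := hn.exists_desc a.left.n b.left.n
      (Gph.hom_n_congr (congrArg CommaMorphism.left w))
    obtain ⟨e, e₁, e₂⟩ := he.exists_desc a.left.e b.left.e
      (Gph.hom_e_congr (congrArg CommaMorphism.left w))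
    refine ⟨mkHom n e ?_ ?_ ?_ ?_, tgph_ext n₁ e₁, tgph_ext n₂ e₂⟩
    · intro x
      rcases he.surj x with ⟨y, rfl⟩ | ⟨y, rfl⟩
      · rw [← h.left.hs, n₁, e₁, a.left.hs]
      · rw [← k.left.hs, n₂, e₂, b.left.hs]
    · intro x
      rcases he.surj x with ⟨y, rfl⟩ | ⟨y, rfl⟩
      · rw [← h.left.ht, n₁, e₁, a.left.ht]
      · rw [← k.left.ht, n₂, e₂, b.left.ht]
    · intro x
      rcases hn.surj x with ⟨y, rfl⟩ | ⟨y, rfl⟩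
      · rw [n₁, typed_n, typed_n]
      · rw [n₂, typed_n, typed_n]
    · intro x
      rcases he.surj x with ⟨y, rfl⟩ | ⟨y, rfl⟩
      · rw [e₁, typed_e, typed_e]
      · rw [e₂, typed_e, typed_e]
  refine ⟨⟨tgph_ext hn.comm he.comm⟩, ⟨PushoutCocone.IsColimit.mk _
    (fun s => (hdesc s.inl s.inr s.condition).choose)
    (fun s => (hdesc s.inl s.inr s.condition).choose_spec.1)
    (fun s => (hdesc s.inl s.inr s.condition).choose_spec.2) ?_⟩⟩
  intro s m h₁ h₂
  have h₃ := (hdesc s.inl s.inr s.condition).choose_spec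
  exact huniq _ _ (h₁.trans h₃.1.symm) (h₂.trans h₃.2.symm)

/-- Both squares of the diagram are pushouts elementwise; in particular, all its morphisms are
mono. -/
structure ElementwiseDPO {p : Rule T} {G H : TGph T} (t : Diagram p G H) : Prop where
  left_n : SetPO p.l.left.n t.d.left.n t.m.left.n t.g.left.n
  left_e : SetPO p.l.left.e t.d.left.e t.m.left.e t.g.left.e
  right_n : SetPO p.r.left.n t.d.left.n t.c.left.n t.h.left.n
  right_e : SetPO p.r.left.e t.d.left.e t.c.left.e t.h.left.e

theorem Diagram.IsDPO.elementwise {p : Rule T} {G H : TGph T} {t : Diagram p G H}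
    (ht : t.IsDPO) : ElementwiseDPO t := by
  have hd : Inj t.d := by
    have h := Inj.comp p.l_inj ht.match_inj
    rw [ht.left.w] at h
    exact ⟨Function.Injective.of_comp h.1, Function.Injective.of_comp h.2⟩
  exact ⟨setPO_n ht.left p.l_inj hd, setPO_e ht.left p.l_inj hd,
    setPO_n ht.right p.r_inj hd, setPO_e ht.right p.r_inj hd⟩

theorem ElementwiseDPO.isDPO {p : Rule T} {G H : TGph T} {t : Diagram p G H}
    (ht : ElementwiseDPO t) : t.IsDPO :=
  ⟨⟨ht.left_n.inl_inj, ht.left_e.inl_inj⟩, isPushout_of_setPO ht.left_n ht.left_e,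
    isPushout_of_setPO ht.right_n ht.right_e⟩

/-- A diagram with the source graph replaced by an isomorphic one. -/
def Diagram.transport {p : Rule T} {G G' H : TGph T} (t : Diagram p G H) (e : G ≅ G') :
    Diagram p G' H where
  D := t.D
  m := t.m ≫ e.hom
  d := t.d
  c := t.c
  g := t.g ≫ e.hom
  h := t.h

theorem Diagram.IsDPO.transport {p : Rule T} {G G' H : TGph T} {t : Diagram p G H}
    (ht : t.IsDPO) (e : G ≅ G') : (t.transport e).IsDPO where
  match_inj := Inj.comp ht.match_inj (Inj.of_iso e)
  left := IsPushout.of_iso ht.left (Iso.refl _) (Iso.refl _) (Iso.refl _) e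
    (by simp) (by simp [Diagram.transport]) (by simp [Diagram.transport])
    (by simp [Diagram.transport])
  right := ht.right

end Typed

/-! ### Reachability -/

/-- There is a conditional transformation from `G` to `H`. -/
def Step (C : CGG.{u, v}) (G H : TGph C.TG) : Prop :=
  ∃ (p : C.P) (t : Diagram (C.rule p) G H), t.IsDPO ∧ SatAll t.m (C.nac p)

theorem Reachable.start (C : CGG.{u, v}) : Reachable C C.Gin :=
  ⟨0, ⟨fun _ => C.Gin, rfl, Fin.elim0, fun i => i.elim0, fun i => i.elim0, fun i => i.elim0⟩, rfl⟩

theorem Reachable.step {C : CGG.{u, v}} {G H : TGph C.TG} (hG : Reachable C G)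
    (h : Step C G H) : Reachable C H := by
  obtain ⟨k, s, rfl⟩ := hG
  let G' : Fin (k + 2) → TGph C.TG := Fin.snoc (α := fun _ => TGph C.TG) s.G H
  have hs : ∀ i : Fin (k + 1), Step C (G' i.castSucc) (G' i.succ) := by
    intro i
    refine Fin.lastCases ?_ (fun i => ?_) i
    · simpa [G', Fin.succ_last] using h
    · have : Step C (s.G i.castSucc) (s.G i.succ) := ⟨s.p i, s.t i, s.dpo i, s.sat i⟩
      rw [Fin.succ_castSucc]
      simpa only [G', Fin.snoc_castSucc] using this
  choose p t h₁ h₂ using hs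
  refine ⟨k + 1, ⟨G', ?_, p, t, h₁, h₂⟩, ?_⟩
  · have : G' (Fin.castSucc 0) = s.G 0 := by simp only [G', Fin.snoc_castSucc]
    exact this.trans s.start
  · simp [G']

/-! ### Shapes of incremental constraints -/

/-- The negative items of the shape consist of one arc `e`, possibly together with end nodes of
`e`: the body is `e` with its end nodes, and the border contains no arc. -/
structure Shape.IsArc {T : Gph.{u}} (σ : Shape T) (e : T.E) : Prop where
  border_E : σ.border.E = ∅
  body_N : σ.body.N = {T.s e, T.t e}
  body_E : σ.body.E = {e}

/-- The shape consists of a single negative node; its border is empty. -/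
structure Shape.IsNode {T : Gph.{u}} (σ : Shape T) (b : T.N) : Prop where
  border_N : σ.border.N = ∅
  border_E : σ.border.E = ∅
  body_N : σ.body.N = {b}
  body_E : σ.body.E = ∅

/-- The subgraphs between the premise and the conclusion of an incremental constraint form a
chain. -/
theorem Incremental.total {T : Gph.{u}} {L : TGph T} {c : Constraint L} (hc : Incremental c)
    (A B : Sub c.N.left) (hA : Sub.range c.n.left ≤ A) (hB : Sub.range c.n.left ≤ B) :
    A ≤ B ∨ B ≤ A := by
  let X : Sub c.N.left → TGph T := fun A => (Over.map c.N.hom).obj A.typed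
  let b : ∀ A, X A ⟶ c.N := fun A => Over.homMk A.typed.hom rfl
  have hb : ∀ A, Inj (b A) := fun A => ⟨Subtype.val_injective, Subtype.val_injective⟩
  let a : ∀ A, Sub.range c.n.left ≤ A → (L ⟶ X A) := fun A h =>
    mkHom (fun x => ⟨c.n.left.n x, h.1 ⟨x, trivial, rfl⟩⟩)
      (fun x => ⟨c.n.left.e x, h.2 ⟨x, trivial, rfl⟩⟩)
      (fun x => Subtype.ext (c.n.left.hs x)) (fun x => Subtype.ext (c.n.left.ht x))
      (fun x => typed_n c.n x) (fun x => typed_e c.n x)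
  have hab : ∀ A h, a A h ≫ b A = c.n := fun A h => tgph_ext (fun _ => rfl) (fun _ => rfl)
  have ha : ∀ A h, Inj (a A h) := fun A h =>
    ⟨fun x y e => c.inj.1 (congrArg Subtype.val e), fun x y e => c.inj.2 (congrArg Subtype.val e)⟩
  have key : ∀ A B (f : X A ⟶ X B), f ≫ b B = b A → A ≤ B := by
    intro A B f hf
    constructor
    · intro x hx
      have h := Gph.hom_n_congr (congrArg CommaMorphism.left hf) ⟨x, hx⟩
      have h' : (f.left.n ⟨x, hx⟩ : B.N).1 = x := h
      exact h' ▸ (f.left.n ⟨x, hx⟩ : B.N).2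
    · intro x hx
      have h := Gph.hom_e_congr (congrArg CommaMorphism.left hf) ⟨x, hx⟩
      have h' : (f.left.e ⟨x, hx⟩ : B.E).1 = x := h
      exact h' ▸ (f.left.e ⟨x, hx⟩ : B.E).2
  rcases hc (X A) (X B) (a A hA) (b A) (a B hB) (b B) (ha A hA) (hb A) (ha B hB) (hb B)
    (hab A hA) (hab B hB) with ⟨f, -, h⟩ | ⟨f, -, h⟩
  · exact Or.inl (key _ _ f h)
  · exact Or.inr (key _ _ f h)

/-- The subgraph consisting of an arc and its end nodes. -/
def Sub.arc {T : Gph.{u}} (e : T.E) : Sub T where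
  N := {T.s e, T.t e}
  E := {e}
  hs := by rintro _ rfl; exact Or.inl rfl
  ht := by rintro _ rfl; exact Or.inr rfl

/-- An incremental constraint that is not an isomorphism forbids one arc (possibly with end
nodes of it) or one isolated node: otherwise two negative items could be added independently of
each other, contradicting incrementality. -/
theorem Incremental.shape_cases {T : Gph.{u}} {L : TGph T} {c : Constraint L}
    (hc : Incremental c) (hiso : ¬ Gph.Bij c.n.left) :
    (∃ e, c.shape.IsArc e) ∨ ∃ b, c.shape.IsNode b := by
  have hE : c.shape.border.E = ∅ := by
    ext e
    simp only [Set.mem_empty_iff_false, iff_false]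
    rintro ⟨e, ⟨h₁, ⟨x, -, rfl⟩⟩, rfl⟩
    exact h₁ ⟨x, rfl⟩
  by_cases h : ∃ e, e ∉ Set.range c.n.left.e
  · obtain ⟨e, he⟩ := h
    have he' : e ∉ (Sub.range c.n.left).E := by rintro ⟨x, -, hx⟩; exact he ⟨x, hx⟩
    have hEE : ∀ e', e' ∉ Set.range c.n.left.e → e' = e := by
      intro e' h'
      have h'' : e' ∉ (Sub.range c.n.left).E := by rintro ⟨x, -, hx⟩; exact h' ⟨x, hx⟩
      rcases hc.total (Sub.range c.n.left ⊔ Sub.arc e) (Sub.range c.n.left ⊔ Sub.arc e')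
        le_sup_left le_sup_left with h | h
      · exact ((h.2 (Or.inr rfl) : e ∈ (Sub.range c.n.left).E ∪ {e'}).resolve_left he').symm
      · exact (h.2 (Or.inr rfl) : e' ∈ (Sub.range c.n.left).E ∪ {e}).resolve_left h''
    have hNN : ∀ v, v ∉ Set.range c.n.left.n → v = c.N.left.s e ∨ v = c.N.left.t e := by
      intro v hv
      have hv' : v ∉ (Sub.range c.n.left).N := by rintro ⟨x, -, hx⟩; exact hv ⟨x, hx⟩
      rcases hc.total (Sub.range c.n.left ⊔ Sub.arc e) (Sub.range c.n.left ⊔ Sub.nodes {v})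
        le_sup_left le_sup_left with h | h
      · exact ((h.2 (Or.inr rfl) : e ∈ (Sub.range c.n.left).E ∪ ∅).resolve_left he').elim
      · exact (h.1 (Or.inr rfl) : v ∈ (Sub.range c.n.left).N ∪ _).resolve_left hv'
    have h₁ : c.negative.N = {c.N.left.s e, c.N.left.t e} := by
      ext v
      constructor
      · rintro (h | ⟨e', h, h'⟩)
        · exact hNN v h
        · rwa [hEE _ h] at h'
      · intro h
        exact Or.inr ⟨e, he, h⟩
    have h₂ : c.negative.E = {e} := by
      ext e'
      exact ⟨fun h => hEE _ h, fun h => by rw [h]; exact he⟩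
    refine Or.inl ⟨c.N.hom.e e, hE, ?_, ?_⟩
    · change c.N.hom.n '' c.negative.N = _
      rw [h₁, Set.image_pair, c.N.hom.hs, c.N.hom.ht]
    · change c.N.hom.e '' c.negative.E = _
      rw [h₂, Set.image_singleton]
  · push Not at h
    have hb : ∃ b, b ∉ Set.range c.n.left.n := by
      by_contra hb
      push Not at hb
      exact hiso ⟨⟨c.inj.1, hb⟩, ⟨c.inj.2, h⟩⟩
    obtain ⟨b, hb⟩ := hb
    have hb' : b ∉ (Sub.range c.n.left).N := by rintro ⟨x, -, hx⟩; exact hb ⟨x, hx⟩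
    have hNN : ∀ v, v ∉ Set.range c.n.left.n → v = b := by
      intro v hv
      have hv' : v ∉ (Sub.range c.n.left).N := by rintro ⟨x, -, hx⟩; exact hv ⟨x, hx⟩
      rcases hc.total (Sub.range c.n.left ⊔ Sub.nodes {b}) (Sub.range c.n.left ⊔ Sub.nodes {v})
        le_sup_left le_sup_left with h | h
      · exact ((h.1 (Or.inr rfl) : b ∈ (Sub.range c.n.left).N ∪ {v}).resolve_left hb').symm
      · exact (h.1 (Or.inr rfl) : v ∈ (Sub.range c.n.left).N ∪ {b}).resolve_left hv'
    have h₁ : c.negative.N = {b} := by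
      ext v
      constructor
      · rintro (h' | ⟨e', h', -⟩)
        · exact hNN v h'
        · exact (h' (h e')).elim
      · intro h'
        rw [h']
        exact Or.inl hb
    have h₂ : c.negative.E = ∅ := Set.eq_empty_of_forall_notMem fun e' h' => h' (h e')
    refine Or.inr ⟨c.N.hom.n b, ?_, hE, ?_, ?_⟩
    · change c.N.hom.n '' (c.negative.N ∩ (Sub.range c.n.left).N) = _
      rw [h₁, Set.singleton_inter_eq_empty.mpr hb', Set.image_empty]
    · change c.N.hom.n '' c.negative.N = _
      rw [h₁, Set.image_singleton]
    · change c.N.hom.e '' c.negative.E = _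
      rw [h₂, Set.image_empty]

theorem Constraint.shape_body_le {T : Gph.{u}} {L : TGph T} (c : Constraint L) :
    c.shape.body ≤ Sub.ofTyped c.N :=
  Sub.map_mono _ ⟨fun _ _ => trivial, fun _ _ => trivial⟩

theorem Constraint.shape_border_le {T : Gph.{u}} {L : TGph T} (c : Constraint L) :
    c.shape.border ≤ Sub.ofTyped L := by
  constructor
  · rintro _ ⟨_, ⟨-, ⟨x, -, rfl⟩⟩, rfl⟩
    exact ⟨x, trivial, (typed_n c.n x).symm⟩
  · rintro _ ⟨_, ⟨-, ⟨x, -, rfl⟩⟩, rfl⟩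
    exact ⟨x, trivial, (typed_e c.n x).symm⟩

/-- Every shape of the grammar is of one of the two kinds. -/
def ShapesCases (C : CGG.{u, v}) : Prop :=
  ∀ σ : shapes C, (∃ e, σ.1.IsArc e) ∨ ∃ b, σ.1.IsNode b

theorem ShapesCases.of_incremental {C : CGG.{u, v}}
    (hinc : ∀ p, ∀ c ∈ C.nac p, Incremental c) (hiso : ∀ p, ∀ c ∈ C.nac p, ¬ Gph.Bij c.n.left) :
    ShapesCases C := by
  rintro ⟨_, p, c, hc, rfl⟩
  exact (hinc p c hc).shape_cases (hiso p c hc)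

theorem ShapesCases.border_E {C : CGG.{u, v}} (hS : ShapesCases C) (σ : shapes C) :
    σ.1.border.E = ∅ := by
  rcases hS σ with ⟨_, h⟩ | ⟨_, h⟩ <;> exact h.border_E

/-! ### Subgraphs of the enriched type graph -/

/-- The part of a subgraph of the enriched type graph that lies in the original type graph. -/
def Sub.old {T : Gph.{u}} {S : Set (Shape T)} (A : Sub (enrich T S)) : Sub T where
  N := {v | Sum.inl v ∈ A.N}
  E := {e | Sum.inl e ∈ A.E}
  hs _ h := A.hs _ h
  ht _ h := A.ht _ h

section Old

variable {T : Gph.{u}} {S : Set (Shape T)}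

theorem Sub.map_le_iff (B : Sub T) (A : Sub (enrich T S)) :
    B.map (enrichIn T S) ≤ A ↔ B ≤ A.old := by
  constructor
  · exact fun h => ⟨fun v hv => h.1 ⟨v, hv, rfl⟩, fun v hv => h.2 ⟨v, hv, rfl⟩⟩
  · intro h
    constructor
    · rintro _ ⟨v, hv, rfl⟩; exact h.1 hv
    · rintro _ ⟨v, hv, rfl⟩; exact h.2 hv

theorem Sub.old_map (B : Sub T) : (B.map (enrichIn T S)).old = B := by
  apply Sub.ext
  · ext v
    exact ⟨fun ⟨w, hw, e⟩ => Sum.inl.inj e ▸ hw, fun h => ⟨v, h, rfl⟩⟩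
  · ext v
    exact ⟨fun ⟨w, hw, e⟩ => Sum.inl.inj e ▸ hw, fun h => ⟨v, h, rfl⟩⟩

theorem Sub.old_sup (A B : Sub (enrich T S)) : (A ⊔ B).old = A.old ⊔ B.old := rfl

theorem inl_mem_range_barN (σ : S) (v : T.N) :
    Sum.inl v ∈ Set.range (barN σ) ↔ v ∈ σ.1.border.N := by
  constructor
  · rintro ⟨w, hw⟩
    by_cases h : w.1 ∈ σ.1.border.N
    · simp only [barN, dif_pos h, Sum.inl.injEq] at hw
      exact hw ▸ h
    · simp [barN, dif_neg h] at hw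
  · intro h
    exact ⟨⟨v, σ.1.le.1 h⟩, by simp [barN, h]⟩

theorem inl_mem_range_barE (σ : S) (v : T.E) :
    Sum.inl v ∈ Set.range (barE σ) ↔ v ∈ σ.1.border.E := by
  constructor
  · rintro ⟨w, hw⟩
    by_cases h : w.1 ∈ σ.1.border.E
    · simp only [barE, dif_pos h, Sum.inl.injEq] at hw
      exact hw ▸ h
    · simp [barE, dif_neg h] at hw
  · intro h
    exact ⟨⟨v, σ.1.le.2 h⟩, by simp [barE, h]⟩

theorem old_union_complement (I : Set S) :
    (Sub.union I complement).old = Sub.union I fun σ => σ.1.border := by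
  apply Sub.ext
  · ext v
    exact exists_congr fun σ => and_congr_right fun _ => inl_mem_range_barN σ v
  · ext v
    exact exists_congr fun σ => and_congr_right fun _ => inl_mem_range_barE σ v

theorem union_border_le {I : Set S} {A : Sub T} (h : ∀ σ ∈ I, σ.1.border ≤ A) :
    Sub.union I (fun σ => σ.1.border) ≤ A :=
  ⟨fun _ ⟨σ, hσ, hv⟩ => (h σ hσ).1 hv, fun _ ⟨σ, hσ, hv⟩ => (h σ hσ).2 hv⟩

/-- The original part does not change when complements are added whose borders are present. -/
theorem old_sup_union {I : Set S} {A : Sub (enrich T S)} {B : Sub T} (hA : A.old = B)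
    (h : ∀ σ ∈ I, σ.1.border ≤ B) : (A ⊔ Sub.union I complement).old = B := by
  rw [Sub.old_sup, old_union_complement, hA]
  exact sup_eq_left.mpr (union_border_le h)

theorem Sub.union_sup_union {T : Gph.{u}} {ι : Type*} (I J : Set ι) (A : ι → Sub T) :
    Sub.union I A ⊔ Sub.union J A = Sub.union (I ∪ J) A := by
  apply Sub.ext
  · ext v
    exact ⟨fun h => h.elim (fun ⟨i, hi, h⟩ => ⟨i, Or.inl hi, h⟩) fun ⟨i, hi, h⟩ => ⟨i, Or.inr hi, h⟩,
      fun ⟨i, hi, h⟩ => hi.imp (fun hi => ⟨i, hi, h⟩) fun hi => ⟨i, hi, h⟩⟩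
  · ext v
    exact ⟨fun h => h.elim (fun ⟨i, hi, h⟩ => ⟨i, Or.inl hi, h⟩) fun ⟨i, hi, h⟩ => ⟨i, Or.inr hi, h⟩,
      fun ⟨i, hi, h⟩ => hi.imp (fun hi => ⟨i, hi, h⟩) fun hi => ⟨i, hi, h⟩⟩

/-- The new arc over an item `e` of a shape. -/
abbrev newE (σ : S) {e : T.E} (he : e ∈ σ.1.body.E) (he' : e ∉ σ.1.border.E) : (enrich T S).E :=
  Sum.inr ⟨σ, e, he, he'⟩

/-- The new node over an item `b` of a shape. -/
abbrev newN (σ : S) {b : T.N} (hb : b ∈ σ.1.body.N) (hb' : b ∉ σ.1.border.N) :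
    (enrich T S).N :=
  Sum.inr ⟨σ, b, hb, hb'⟩

theorem newE_notMem_map (B : Sub T) (σ : S) {e : T.E} (he : e ∈ σ.1.body.E)
    (he' : e ∉ σ.1.border.E) : newE σ he he' ∉ (B.map (enrichIn T S)).E := by
  rintro ⟨_, _, h⟩
  cases h

theorem newN_notMem_map (B : Sub T) (σ : S) {b : T.N} (hb : b ∈ σ.1.body.N)
    (hb' : b ∉ σ.1.border.N) : newN σ hb hb' ∉ (B.map (enrichIn T S)).N := by
  rintro ⟨_, _, h⟩
  cases h

theorem newE_mem_union (I : Set S) (σ : S) {e : T.E} (he : e ∈ σ.1.body.E)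
    (he' : e ∉ σ.1.border.E) : newE σ he he' ∈ (Sub.union I complement).E ↔ σ ∈ I := by
  constructor
  · rintro ⟨τ, hτ, w, hw⟩
    by_cases h : w.1 ∈ τ.1.border.E
    · simp [barE, dif_pos h] at hw
    · simp only [barE, dif_neg h] at hw
      have h' : τ = σ := congrArg Sigma.fst (Sum.inr.inj hw)
      exact h' ▸ hτ
  · intro h
    exact ⟨σ, h, ⟨e, he⟩, by simp only [barE, dif_neg he']; rfl⟩

theorem newN_mem_union (I : Set S) (σ : S) {b : T.N} (hb : b ∈ σ.1.body.N)
    (hb' : b ∉ σ.1.border.N) : newN σ hb hb' ∈ (Sub.union I complement).N ↔ σ ∈ I := by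
  constructor
  · rintro ⟨τ, hτ, w, hw⟩
    by_cases h : w.1 ∈ τ.1.border.N
    · simp [barN, dif_pos h] at hw
    · simp only [barN, dif_neg h] at hw
      have h' : τ = σ := congrArg Sigma.fst (Sum.inr.inj hw)
      exact h' ▸ hτ
  · intro h
    exact ⟨σ, h, ⟨b, hb⟩, by simp only [barN, dif_neg hb']; rfl⟩

end Old

/-! ### The complemented rules -/

variable {C : CGG.{u, v}}

/-- The shape `σ` is not a shape of a constraint of `p`, and the rule deletes part of the body of `σ`,
but nothing of the border. This is the condition under which `step1` creates the complement, in
terms of the original rule. -/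
structure DestroysBody (p : C.P) (σ : shapes C) : Prop where
  other : σ ∈ otherShapes p
  body_le : σ.1.body ≤ Sub.ofTyped (C.rule p).L
  not_body_le : ¬ σ.1.body ≤ Sub.ofTyped (C.rule p).K
  border_le : σ.1.border ≤ Sub.ofTyped (C.rule p).K

/-- The rule creates part of the body of `σ`, but nothing of the border: the condition under which
`step2` deletes the complement. -/
structure CreatesBody (p : C.P) (σ : shapes C) : Prop where
  other : σ ∈ otherShapes p
  body_le : σ.1.body ≤ Sub.ofTyped (C.rule p).R
  not_body_le : ¬ σ.1.body ≤ Sub.ofTyped (C.rule p).K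
  border_le : σ.1.border ≤ Sub.ofTyped (C.rule p).K

/-- The rule creates part of the border of `σ`, without the body: the condition under which `step3`
creates the complement. -/
structure CreatesBorder (p : C.P) (σ : shapes C) : Prop where
  other : σ ∈ otherShapes p
  border_le : σ.1.border ≤ Sub.ofTyped (C.rule p).R
  not_border_le : ¬ σ.1.border ≤ Sub.ofTyped (C.rule p).K
  not_body_le : ¬ σ.1.body ≤ Sub.ofTyped (C.rule p).R

theorem old_asSub (X : TGph C.TG) : (asSub C X).old = Sub.ofTyped X := Sub.old_map _

theorem bodyIn_le_iff (σ : shapes C) (A : Sub (TGbar C)) :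
    bodyIn C σ ≤ A ↔ σ.1.body ≤ A.old := Sub.map_le_iff _ _

theorem borderIn_le_iff (σ : shapes C) (A : Sub (TGbar C)) :
    borderIn C σ ≤ A ↔ σ.1.border ≤ A.old := Sub.map_le_iff _ _

theorem border_le_of_ownShapes {p : C.P} {σ : shapes C} (h : σ ∈ ownShapes p) :
    σ.1.border ≤ Sub.ofTyped (C.rule p).L := by
  obtain ⟨c, -, hc⟩ := h
  rw [hc]
  exact c.shape_border_le

/-- A rule that keeps a complement preserves the border: a border node that is deleted would leave
the complemented arc dangling. -/
theorem KeepsComplement.border_le (hS : ShapesCases C) {p : C.P} {σ : shapes C}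
    (hσ : σ ∈ ownShapes p) (h : KeepsComplement p σ) :
    σ.1.border ≤ Sub.ofTyped (C.rule p).K := by
  obtain ⟨⟨H, t, ht, hm⟩, -⟩ := h
  have hwd := ht.elementwise
  refine ⟨fun w hw => ?_, by rw [hS.border_E σ]; exact Set.empty_subset _⟩
  rcases hS σ with ⟨e, he⟩ | ⟨b, hb⟩
  swap
  · rw [hb.border_N] at hw
    exact hw.elim
  have heb : e ∈ σ.1.body.E := by rw [he.body_E]; rfl
  have hen : e ∉ σ.1.border.E := by rw [he.border_E]; exact Set.notMem_empty _
  have hL : ∀ x : ((baseRule p).L ⊔ complement σ).typed.left.N, x.1 = Sum.inl w →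
      ∃ y, t.m.left.n y = x := by
    intro x hx
    refine ⟨⟨Sum.inl w, ⟨w, (border_le_of_ownShapes hσ).1 hw, rfl⟩⟩, Subtype.ext ?_⟩
    rw [hx]
    exact typed_n t.m _
  -- the node `w` is an end of the complemented arc, which is not deleted
  have key : ∀ z : t.D.left.N, (t.g.left.n z : ((baseRule p).L ⊔ complement σ).N).1 = Sum.inl w →
      w ∈ (Sub.ofTyped (C.rule p).K).N := by
    intro z hz
    obtain ⟨y, hy⟩ := hL _ hz
    obtain ⟨k, hk, -⟩ := hwd.left_n.pull y z hy
    have h₁ := typed_n t.m y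
    rw [hy] at h₁
    have h₂ : k.1 = Sum.inl w := (congrArg Subtype.val hk).trans (h₁.symm.trans hz)
    have h₃ := k.2
    rw [h₂] at h₃
    obtain ⟨v, hv, hvw⟩ := h₃
    exact Sum.inl.inj hvw ▸ hv
  let x : ((baseRule p).L ⊔ complement σ).typed.left.E := ⟨newE σ heb hen, Or.inr ⟨⟨e, heb⟩, by
    simp only [barE, dif_neg hen]; rfl⟩⟩
  rcases hwd.left_e.surj x with ⟨y, hy⟩ | ⟨d, hd⟩
  · have h₁ := typed_e t.m y
    rw [hy] at h₁
    have h₂ : newE σ heb hen = y.1 := h₁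
    exact (newE_notMem_map _ σ heb hen (h₂ ▸ y.2)).elim
  · have hb : w = C.TG.s e ∨ w = C.TG.t e := by
      have := σ.1.le.1 hw
      rwa [he.body_N] at this
    rcases hb with rfl | rfl
    · refine key (t.D.left.s d) ?_
      rw [t.g.left.hs, hd]
      change barN σ ⟨C.TG.s e, _⟩ = _
      simp only [barN, dif_pos hw]
    · refine key (t.D.left.t d) ?_
      rw [t.g.left.ht, hd]
      change barN σ ⟨C.TG.t e, _⟩ = _
      simp only [barN, dif_pos hw]

/-- The own shapes of `p` whose complements are preserved. -/
def KeptShapes (p : C.P) : Set (shapes C) := {σ ∈ ownShapes p | KeepsComplement p σ}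

theorem step1_R (hS : ShapesCases C) (p : C.P) : (step1 p).R =
    asSub C (C.rule p).R ⊔ Sub.union (KeptShapes p ∪ {σ | DestroysBody p σ}) complement := by
  rw [← Sub.union_sup_union, ← sup_assoc]
  have hL : (complRule p).L.old = Sub.ofTyped (C.rule p).L :=
    old_sup_union (old_asSub _) fun σ hσ => border_le_of_ownShapes hσ
  have hK : (complRule p).K.old = Sub.ofTyped (C.rule p).K :=
    old_sup_union (old_asSub _) fun σ hσ => KeepsComplement.border_le hS hσ.1 hσ.2
  have : {σ | DestroysBody p σ} = {σ ∈ otherShapes p | bodyIn C σ ≤ (complRule p).L ∧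
    ¬ bodyIn C σ ≤ (complRule p).K ∧ borderIn C σ ≤ (complRule p).K} := by
    ext σ
    simp only [Set.mem_ofPred_eq, bodyIn_le_iff, borderIn_le_iff, hL, hK]
    exact ⟨fun h => ⟨h.1, h.2, h.3, h.4⟩, fun h => ⟨h.1, h.2.1, h.2.2.1, h.2.2.2⟩⟩
  rw [this]
  rfl

theorem old_step1_R (hS : ShapesCases C) (p : C.P) :
    (step1 p).R.old = Sub.ofTyped (C.rule p).R := by
  rw [step1_R hS]
  refine old_sup_union (old_asSub _) fun σ hσ => le_trans ?_ (Sub.ofTyped_mono (C.rule p).r)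
  rcases hσ with hσ | hσ
  · exact KeepsComplement.border_le hS hσ.1 hσ.2
  · exact hσ.border_le

theorem step3_K (p : C.P) : (step3 p).K =
    asSub C (C.rule p).K ⊔ Sub.union (KeptShapes p) complement := rfl

theorem old_step3_K (hS : ShapesCases C) (p : C.P) :
    (step3 p).K.old = Sub.ofTyped (C.rule p).K :=
  old_sup_union (old_asSub _) fun _ hσ => KeepsComplement.border_le hS hσ.1 hσ.2

theorem step3_L (hS : ShapesCases C) (p : C.P) : (step3 p).L =
    asSub C (C.rule p).L ⊔ Sub.union (ownShapes p ∪ {σ | CreatesBody p σ}) complement := by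
  rw [← Sub.union_sup_union, ← sup_assoc]
  have : {σ | CreatesBody p σ} = {σ ∈ otherShapes p | bodyIn C σ ≤ (step1 p).R ∧
    ¬ bodyIn C σ ≤ (step1 p).K ∧ borderIn C σ ≤ (step1 p).K} := by
    ext σ
    have hK : (step1 p).K.old = Sub.ofTyped (C.rule p).K := old_step3_K hS p
    simp only [Set.mem_ofPred_eq, bodyIn_le_iff, borderIn_le_iff, old_step1_R hS, hK]
    exact ⟨fun h => ⟨h.1, h.2, h.3, h.4⟩, fun h => ⟨h.1, h.2.1, h.2.2.1, h.2.2.2⟩⟩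
  rw [this]
  rfl

theorem old_step3_L (hS : ShapesCases C) (p : C.P) :
    (step3 p).L.old = Sub.ofTyped (C.rule p).L := by
  rw [step3_L hS]
  refine old_sup_union (old_asSub _) fun σ hσ => ?_
  rcases hσ with hσ | hσ
  · exact border_le_of_ownShapes hσ
  · exact hσ.border_le.trans (Sub.ofTyped_mono (C.rule p).l)

theorem step3_R (hS : ShapesCases C) (p : C.P) : (step3 p).R = asSub C (C.rule p).R ⊔
    Sub.union (KeptShapes p ∪ {σ | DestroysBody p σ} ∪ {σ | CreatesBorder p σ}) complement := by
  rw [← Sub.union_sup_union, ← sup_assoc, ← step1_R hS]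
  have : {σ | CreatesBorder p σ} = {σ ∈ otherShapes p | borderIn C σ ≤ (step2 p).R ∧
    ¬ borderIn C σ ≤ (step2 p).K ∧ ¬ bodyIn C σ ≤ (step2 p).R} := by
    ext σ
    have hK : (step2 p).K.old = Sub.ofTyped (C.rule p).K := old_step3_K hS p
    have hR : (step2 p).R.old = Sub.ofTyped (C.rule p).R := old_step1_R hS p
    simp only [Set.mem_ofPred_eq, bodyIn_le_iff, borderIn_le_iff, hR, hK]
    exact ⟨fun h => ⟨h.1, h.2, h.3, h.4⟩, fun h => ⟨h.1, h.2.1, h.2.2.1, h.2.2.2⟩⟩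
  rw [this]
  rfl

theorem old_step3_R (hS : ShapesCases C) (p : C.P) :
    (step3 p).R.old = Sub.ofTyped (C.rule p).R := by
  rw [step3_R hS]
  refine old_sup_union (old_asSub _) fun σ hσ => ?_
  rcases hσ with (hσ | hσ) | hσ
  · exact (KeepsComplement.border_le hS hσ.1 hσ.2).trans (Sub.ofTyped_mono (C.rule p).r)
  · exact hσ.border_le.trans (Sub.ofTyped_mono (C.rule p).r)
  · exact hσ.border_le

/-- A completed shape: part of its border is created by the rule, and part of it is not in the
right-hand side. -/
structure CompletesBorder (p : C.P) (σ : shapes C) : Prop where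
  not_border_le : ¬ σ.1.border ≤ Sub.ofTyped (C.rule p).R
  created : ∃ a ∈ σ.1.border.N, a ∈ (Sub.ofTyped (C.rule p).R).N ∧
    a ∉ (Sub.ofTyped (C.rule p).K).N

/-- The condition for an extension, stated for the rule extended so far, implies the one for the
original rule, since the nodes added so far are preserved. -/
theorem Completion.completesBorder (hS : ShapesCases C) {p : C.P} {Z : Set (shapes C)}
    (h : Completion p Z) : ∀ σ ∈ Z, CompletesBorder p σ := by
  induction h with
  | start => exact fun _ h => h.elim
  | extend Z σ _ _ _ hb hne ih =>
    rintro τ (rfl | hτ)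
    swap
    · exact ih τ hτ
    refine ⟨fun h => hb ?_, ?_⟩
    · rw [borderIn_le_iff]
      rw [finalR, Sub.old_sup, old_step3_R hS]
      exact h.trans le_sup_left
    · by_contra hno
      push Not at hno
      have hR : ∀ v, Sum.inl v ∈ (step3 p).R.N ↔ v ∈ (Sub.ofTyped (C.rule p).R).N := fun v => by
        rw [← old_step3_R hS]; rfl
      have hK : ∀ v, Sum.inl v ∈ (step3 p).K.N ↔ v ∈ (Sub.ofTyped (C.rule p).K).N := fun v => by
        rw [← old_step3_K hS]; rfl
      apply hne
      apply Sub.ext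
      · ext v
        constructor
        · rintro ⟨h₁ | h₁, h₂⟩
          · exact ⟨Or.inl ((step3 p).hR.1 h₁), h₂⟩
          · exact ⟨addedNodes_subset p Z h₁, h₂⟩
        · rintro ⟨h₁, v, hv, rfl⟩
          refine ⟨?_, ⟨v, hv, rfl⟩⟩
          by_cases h₂ : Sum.inl v ∈ (step3 p).R.N
          · exact Or.inl ((hK v).2 (hno v hv ((hR v).1 h₂)))
          · obtain ⟨ρ, hρ, h₃⟩ := h₁.resolve_left h₂
            exact Or.inr ⟨ρ, hρ, ⟨v, (inl_mem_range_barN ρ v).1 h₃, rfl⟩, h₂⟩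
      · have : (borderIn C τ).E = ∅ := by
          change _ '' τ.1.border.E = ∅
          rw [hS.border_E, Set.image_empty]
        change _ ∩ (borderIn C τ).E = _ ∩ (borderIn C τ).E
        rw [this, Set.inter_empty, Set.inter_empty]

/-! ### Restriction to the original type graph -/

/-- The part of a graph over the enriched type graph that is typed in the original type graph. -/
noncomputable abbrev restrict (H : TGph (TGbar C)) : TGph C.TG :=
  (pullbackFunctor (inTG C)).obj H

/-- The inclusion of `A` in `A + S`. -/
def Sub.plusInl {T : Gph.{u}} (A : Sub T) (S : Set T.N) : A.typed ⟶ A.plus S :=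
  mkHom Sum.inl id (fun _ => rfl) (fun _ => rfl) (fun _ => rfl) (fun _ => rfl)

/-- A morphism from a subgraph `A` of the enriched type graph, restricted to a typed graph `X`
whose image lies in `A`. -/
noncomputable def toRestrict {X : TGph C.TG} {A : Sub (TGbar C)} {H : TGph (TGbar C)}
    (h : Sub.ofTyped X ≤ A.old) (f : A.typed ⟶ H) : X ⟶ restrict H :=
  mkHom (B := restrict H)
    (fun x => ⟨(X.hom.n x, f.left.n ⟨Sum.inl (X.hom.n x), h.1 ⟨x, trivial, rfl⟩⟩),
      (typed_n f ⟨Sum.inl (X.hom.n x), h.1 ⟨x, trivial, rfl⟩⟩).symm⟩)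
    (fun x => ⟨(X.hom.e x, f.left.e ⟨Sum.inl (X.hom.e x), h.2 ⟨x, trivial, rfl⟩⟩),
      (typed_e f ⟨Sum.inl (X.hom.e x), h.2 ⟨x, trivial, rfl⟩⟩).symm⟩)
    (fun x => Subtype.ext (Prod.ext (X.hom.hs x) (by
      refine Eq.trans ?_ (f.left.hs _)
      exact congrArg f.left.n (Subtype.ext (congrArg Sum.inl (X.hom.hs x))))))
    (fun x => Subtype.ext (Prod.ext (X.hom.ht x) (by
      refine Eq.trans ?_ (f.left.ht _)
      exact congrArg f.left.n (Subtype.ext (congrArg Sum.inl (X.hom.ht x))))))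
    (fun _ => rfl) (fun _ => rfl)

theorem ofTyped_L_le (hS : ShapesCases C) (p : C.P) :
    Sub.ofTyped (C.rule p).L ≤ (step3 p).L.old := (old_step3_L hS p).ge

theorem ofTyped_K_le (hS : ShapesCases C) (p : C.P) :
    Sub.ofTyped (C.rule p).K ≤ (step3 p).K.old := (old_step3_K hS p).ge

theorem ofTyped_R_le (hS : ShapesCases C) (p : C.P) (Z : Set (shapes C)) :
    Sub.ofTyped (C.rule p).R ≤ (finalR p Z).old := by
  rw [finalR, Sub.old_sup, old_step3_R hS]
  exact le_sup_left

/-- The transformation by the original rule below a transformation by a final rule. -/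
noncomputable def Diagram.restrict (hS : ShapesCases C) {p : C.P} {Z : Set (shapes C)}
    {G H : TGph (TGbar C)} (t : Diagram (finalRule p Z) G H) :
    Diagram (C.rule p) (restrict G) (restrict H) where
  D := GraphGrammar.restrict t.D
  m := toRestrict (ofTyped_L_le hS p) (Sub.plusInl _ _ ≫ t.m)
  d := toRestrict (ofTyped_K_le hS p) (Sub.plusInl _ _ ≫ t.d)
  c := toRestrict (ofTyped_R_le hS p Z) t.c
  g := (pullbackFunctor (inTG C)).map t.g
  h := (pullbackFunctor (inTG C)).map t.h

theorem exists_of_mem_ofTyped_n {X : TGph C.TG} {A : Sub (TGbar C)} (hA : A.old = Sub.ofTyped X)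
    {v : C.TG.N} (hv : Sum.inl v ∈ A.N) : ∃ x : X.left.N, X.hom.n x = v := by
  have h : v ∈ A.old.N := hv
  rw [hA] at h
  obtain ⟨x, -, hx⟩ := h
  exact ⟨x, hx⟩

theorem exists_of_mem_ofTyped_e {X : TGph C.TG} {A : Sub (TGbar C)} (hA : A.old = Sub.ofTyped X)
    {v : C.TG.E} (hv : Sum.inl v ∈ A.E) : ∃ x : X.left.E, X.hom.e x = v := by
  have h : v ∈ A.old.E := hv
  rw [hA] at h
  obtain ⟨x, -, hx⟩ := h
  exact ⟨x, hx⟩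

theorem inl_mem_step3_R (hS : ShapesCases C) {p : C.P} {v : C.TG.N} :
    Sum.inl v ∈ (step3 p).R.N ↔ v ∈ (Sub.ofTyped (C.rule p).R).N := by
  rw [← old_step3_R hS]; rfl

theorem inl_mem_finalR_n {p : C.P} {Z : Set (shapes C)} {v : C.TG.N}
    (hv : Sum.inl v ∈ (finalR p Z).N) :
    Sum.inl v ∈ (step3 p).R.N ∨ Sum.inl v ∈ addedNodes p Z := by
  by_cases h : Sum.inl v ∈ (step3 p).R.N
  · exact Or.inl h
  · obtain ⟨σ, hσ, h₁⟩ := hv.resolve_left h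
    exact Or.inr ⟨σ, hσ, ⟨v, (inl_mem_range_barN σ v).1 h₁, rfl⟩, h⟩

theorem inl_mem_finalR_e (hS : ShapesCases C) {p : C.P} {Z : Set (shapes C)} {e : C.TG.E}
    (he : Sum.inl e ∈ (finalR p Z).E) : Sum.inl e ∈ (step3 p).R.E := by
  rcases he with h | ⟨σ, hσ, h₁⟩
  · exact h
  · have := (inl_mem_range_barE σ e).1 h₁
    rw [hS.border_E] at this
    exact this.elim

/-- A double-pushout diagram by a final rule restricts to one by the original rule. -/
theorem ElementwiseDPO.restrict (hS : ShapesCases C) (hsafe : Safe C) {p : C.P}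
    {Z : Set (shapes C)} {G H : TGph (TGbar C)} {t : Diagram (finalRule p Z) G H}
    (ht : ElementwiseDPO t) : ElementwiseDPO (t.restrict hS) where
  left_n :=
    { comm := fun a => Subtype.ext (Prod.ext (typed_n (C.rule p).l a) (by
        refine Eq.trans ?_ (ht.left_n.comm _)
        exact congrArg t.m.left.n (congrArg Sum.inl
          (Subtype.ext (congrArg Sum.inl (typed_n (C.rule p).l a))))))
      inl_inj := fun x y h =>
        (hsafe.L_inj p).1 (congrArg (fun z : (GraphGrammar.restrict G).left.N => z.1.1) h)
      inr_inj := fun x y h => Subtype.ext (Prod.ext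
        (congrArg (fun z : (GraphGrammar.restrict G).left.N => z.1.1) h)
        (ht.left_n.inr_inj (congrArg (fun z : (GraphGrammar.restrict G).left.N => z.1.2) h)))
      surj := by
        rintro ⟨⟨v, x⟩, hx⟩
        rcases ht.left_n.surj x with ⟨y, rfl⟩ | ⟨z, rfl⟩
        · rcases y with y | s
          · have hy : Sum.inl v = y.1 := hx.trans (typed_n t.m _)
            obtain ⟨w, rfl⟩ := exists_of_mem_ofTyped_n (old_step3_L hS p) (hy ▸ y.2)
            exact Or.inl ⟨w, Subtype.ext (Prod.ext rfl
              (congrArg t.m.left.n (congrArg Sum.inl (Subtype.ext hy))))⟩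
          · have hy : t.m.left.n (Sum.inr s) = t.g.left.n (t.d.left.n (Sum.inr s)) :=
              ht.left_n.comm (Sum.inr s)
            exact Or.inr ⟨⟨(v, t.d.left.n (Sum.inr s)), (hx.trans (congrArg _ hy)).trans
              (typed_n t.g _)⟩, Subtype.ext (Prod.ext rfl hy.symm)⟩
        · exact Or.inr ⟨⟨(v, z), hx.trans (typed_n t.g _)⟩, rfl⟩
      pull := by
        rintro y ⟨⟨v, z⟩, hz⟩ h
        have h₁ : (C.rule p).L.hom.n y = v :=
          congrArg (fun z : (GraphGrammar.restrict G).left.N => z.1.1) h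
        subst h₁
        obtain ⟨k, hk₁, hk₂⟩ := ht.left_n.pull _ _
          (congrArg (fun z : (GraphGrammar.restrict G).left.N => z.1.2) h)
        rcases k with k | s
        swap
        · cases hk₁
        have hk : k.1 = Sum.inl ((C.rule p).L.hom.n y) := congrArg Subtype.val (Sum.inl.inj hk₁)
        obtain ⟨w, hw⟩ := exists_of_mem_ofTyped_n (old_step3_K hS p) (hk ▸ k.2)
        refine ⟨w, (hsafe.L_inj p).1 ((typed_n _ w).trans hw), Subtype.ext (Prod.ext hw ?_)⟩
        refine Eq.trans ?_ hk₂
        exact congrArg t.d.left.n (congrArg Sum.inl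
          (Subtype.ext ((congrArg Sum.inl hw).trans hk.symm))) }
  left_e :=
    { comm := fun a => Subtype.ext (Prod.ext (typed_e (C.rule p).l a) (by
        refine Eq.trans ?_ (ht.left_e.comm _)
        exact congrArg t.m.left.e
          (Subtype.ext (congrArg Sum.inl (typed_e (C.rule p).l a)))))
      inl_inj := fun x y h =>
        (hsafe.L_inj p).2 (congrArg (fun z : (GraphGrammar.restrict G).left.E => z.1.1) h)
      inr_inj := fun x y h => Subtype.ext (Prod.ext
        (congrArg (fun z : (GraphGrammar.restrict G).left.E => z.1.1) h)
        (ht.left_e.inr_inj (congrArg (fun z : (GraphGrammar.restrict G).left.E => z.1.2) h)))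
      surj := by
        rintro ⟨⟨v, x⟩, hx⟩
        rcases ht.left_e.surj x with ⟨y, rfl⟩ | ⟨z, rfl⟩
        · have hy : Sum.inl v = y.1 := hx.trans (typed_e t.m _)
          obtain ⟨w, rfl⟩ := exists_of_mem_ofTyped_e (old_step3_L hS p) (hy ▸ y.2)
          exact Or.inl ⟨w, Subtype.ext (Prod.ext rfl (congrArg t.m.left.e (Subtype.ext hy)))⟩
        · exact Or.inr ⟨⟨(v, z), hx.trans (typed_e t.g _)⟩, rfl⟩
      pull := by
        rintro y ⟨⟨v, z⟩, hz⟩ h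
        have h₁ : (C.rule p).L.hom.e y = v :=
          congrArg (fun z : (GraphGrammar.restrict G).left.E => z.1.1) h
        subst h₁
        obtain ⟨k, hk₁, hk₂⟩ := ht.left_e.pull _ _
          (congrArg (fun z : (GraphGrammar.restrict G).left.E => z.1.2) h)
        have hk : k.1 = Sum.inl ((C.rule p).L.hom.e y) := congrArg Subtype.val hk₁
        obtain ⟨w, hw⟩ := exists_of_mem_ofTyped_e (old_step3_K hS p) (hk ▸ k.2)
        refine ⟨w, (hsafe.L_inj p).2 ((typed_e _ w).trans hw), Subtype.ext (Prod.ext hw ?_)⟩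
        refine Eq.trans ?_ hk₂
        exact congrArg t.d.left.e (Subtype.ext ((congrArg Sum.inl hw).trans hk.symm)) }
  right_n :=
    { comm := fun a => Subtype.ext (Prod.ext (typed_n (C.rule p).r a) (by
        refine Eq.trans ?_ (ht.right_n.comm _)
        exact congrArg t.c.left.n
          (Subtype.ext (congrArg Sum.inl (typed_n (C.rule p).r a)))))
      inl_inj := fun x y h =>
        (hsafe.R_inj p).1 (congrArg (fun z : (GraphGrammar.restrict H).left.N => z.1.1) h)
      inr_inj := fun x y h => Subtype.ext (Prod.ext
        (congrArg (fun z : (GraphGrammar.restrict H).left.N => z.1.1) h)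
        (ht.right_n.inr_inj (congrArg (fun z : (GraphGrammar.restrict H).left.N => z.1.2) h)))
      surj := by
        rintro ⟨⟨v, x⟩, hx⟩
        rcases ht.right_n.surj x with ⟨y, rfl⟩ | ⟨z, rfl⟩
        · have hy : Sum.inl v = y.1 := hx.trans (typed_n t.c _)
          rcases inl_mem_finalR_n (hy ▸ y.2) with h | h
          · obtain ⟨w, rfl⟩ := exists_of_mem_ofTyped_n (old_step3_R hS p) h
            exact Or.inl ⟨w, Subtype.ext (Prod.ext rfl
              (congrArg t.c.left.n (Subtype.ext hy)))⟩
          · have h' : t.c.left.n y = t.h.left.n (t.d.left.n (Sum.inr ⟨_, h⟩)) := by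
              refine Eq.trans ?_ (ht.right_n.comm (Sum.inr ⟨_, h⟩))
              exact congrArg t.c.left.n (Subtype.ext hy.symm)
            exact Or.inr ⟨⟨(v, t.d.left.n (Sum.inr ⟨_, h⟩)), (hx.trans (congrArg _ h')).trans
              (typed_n t.h _)⟩, Subtype.ext (Prod.ext rfl h'.symm)⟩
        · exact Or.inr ⟨⟨(v, z), hx.trans (typed_n t.h _)⟩, rfl⟩
      pull := by
        rintro y ⟨⟨v, z⟩, hz⟩ h
        have h₁ : (C.rule p).R.hom.n y = v :=
          congrArg (fun z : (GraphGrammar.restrict H).left.N => z.1.1) h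
        subst h₁
        obtain ⟨k, hk₁, hk₂⟩ := ht.right_n.pull _ _
          (congrArg (fun z : (GraphGrammar.restrict H).left.N => z.1.2) h)
        rcases k with k | s
        · have hk : k.1 = Sum.inl ((C.rule p).R.hom.n y) := congrArg Subtype.val hk₁
          obtain ⟨w, hw⟩ := exists_of_mem_ofTyped_n (old_step3_K hS p) (hk ▸ k.2)
          refine ⟨w, (hsafe.R_inj p).1 ((typed_n _ w).trans hw), Subtype.ext (Prod.ext hw ?_)⟩
          refine Eq.trans ?_ hk₂
          exact congrArg t.d.left.n (congrArg Sum.inl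
            (Subtype.ext ((congrArg Sum.inl hw).trans hk.symm)))
        · -- added nodes are not in the original right-hand side
          have hk : s.1 = Sum.inl ((C.rule p).R.hom.n y) := congrArg Subtype.val hk₁
          obtain ⟨_, _, _, h₃⟩ := s.2
          rw [hk] at h₃
          exact (h₃ ((inl_mem_step3_R hS).2 ⟨y, trivial, rfl⟩)).elim }
  right_e :=
    { comm := fun a => Subtype.ext (Prod.ext (typed_e (C.rule p).r a) (by
        refine Eq.trans ?_ (ht.right_e.comm _)
        exact congrArg t.c.left.e
          (Subtype.ext (congrArg Sum.inl (typed_e (C.rule p).r a)))))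
      inl_inj := fun x y h =>
        (hsafe.R_inj p).2 (congrArg (fun z : (GraphGrammar.restrict H).left.E => z.1.1) h)
      inr_inj := fun x y h => Subtype.ext (Prod.ext
        (congrArg (fun z : (GraphGrammar.restrict H).left.E => z.1.1) h)
        (ht.right_e.inr_inj (congrArg (fun z : (GraphGrammar.restrict H).left.E => z.1.2) h)))
      surj := by
        rintro ⟨⟨v, x⟩, hx⟩
        rcases ht.right_e.surj x with ⟨y, rfl⟩ | ⟨z, rfl⟩
        · have hy : Sum.inl v = y.1 := hx.trans (typed_e t.c _)
          obtain ⟨w, rfl⟩ := exists_of_mem_ofTyped_e (old_step3_R hS p)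
            (inl_mem_finalR_e hS (hy ▸ y.2))
          exact Or.inl ⟨w, Subtype.ext (Prod.ext rfl (congrArg t.c.left.e (Subtype.ext hy)))⟩
        · exact Or.inr ⟨⟨(v, z), hx.trans (typed_e t.h _)⟩, rfl⟩
      pull := by
        rintro y ⟨⟨v, z⟩, hz⟩ h
        have h₁ : (C.rule p).R.hom.e y = v :=
          congrArg (fun z : (GraphGrammar.restrict H).left.E => z.1.1) h
        subst h₁
        obtain ⟨k, hk₁, hk₂⟩ := ht.right_e.pull _ _
          (congrArg (fun z : (GraphGrammar.restrict H).left.E => z.1.2) h)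
        have hk : k.1 = Sum.inl ((C.rule p).R.hom.e y) := congrArg Subtype.val hk₁
        obtain ⟨w, hw⟩ := exists_of_mem_ofTyped_e (old_step3_K hS p) (hk ▸ k.2)
        refine ⟨w, (hsafe.R_inj p).2 ((typed_e _ w).trans hw), Subtype.ext (Prod.ext hw ?_)⟩
        refine Eq.trans ?_ hk₂
        exact congrArg t.d.left.e (Subtype.ext ((congrArg Sum.inl hw).trans hk.symm)) }

/-! ### The invariant -/

/-- At most one element has the type `new`, and none has the type `old` if one has the type
`new`. -/
structure Exclusive {X Y : Type*} (τ : X → Y) (new old : Y) : Prop where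
  subsingleton : ∀ x y, τ x = new → τ y = new → x = y
  not_both : ∀ x y, τ x = new → τ y ≠ old

/-- If the only element of type `y` of a pushout is the image of an element on one side that does
not come from the interface, then there is no element of type `y` on the other side. -/
theorem SetPO.not_preserved {A B D G : Type u} {Y : Type*} {f : A → B} {g : A → D} {h : B → G}
    {k : D → G} (H : SetPO f g h k) {τ : G → Y} {y : Y}
    (hτ : ∀ a b, τ a = y → τ b = y → a = b) {b : B} (hb : τ (h b) = y) (hf : ∀ a, f a ≠ b) (d : D) :
    τ (k d) ≠ y := by
  intro hd
  obtain ⟨a, ha, -⟩ := H.pull b d (hτ _ _ hb hd)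
  exact hf a ha

/-- Conditions on a double-pushout step, in terms of created and of preserved items, under which
exclusiveness is preserved. -/
theorem Exclusive.of_setPO {K L R D G H : Type u} {Y : Type*} {l : K → L} {r : K → R} {d : K → D}
    {m : L → G} {c : R → H} {g : D → G} {h : D → H} (H₁ : SetPO l d m g) (H₂ : SetPO r d c h)
    {τG : G → Y} {τH : H → Y} (hτ : ∀ x, τG (g x) = τH (h x)) {new old : Y}
    (hG : Exclusive τG new old)
    (hR : ∀ x y, τH (c x) = new → τH (c y) = new → x = y)
    (hnew : ∀ x, (∀ k, r k ≠ x) → τH (c x) = new → (∀ z, τG (g z) ≠ new) ∧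
      (∀ z, τG (g z) ≠ old) ∧ ∀ y, (∀ k, r k ≠ y) → τH (c y) ≠ old)
    (hold : ∀ x, (∀ k, r k ≠ x) → τH (c x) = old → ∀ z, τG (g z) ≠ new) :
    Exclusive τH new old := by
  have hcases : ∀ y, (∃ z, h z = y) ∨ ∃ x, (∀ k, r k ≠ x) ∧ c x = y := by
    intro y
    rcases H₂.surj y with ⟨x, rfl⟩ | hz
    · by_cases hk : ∃ k, r k = x
      · obtain ⟨k, rfl⟩ := hk
        exact Or.inl ⟨d k, (H₂.comm k).symm⟩
      · exact Or.inr ⟨x, fun k hk' => hk ⟨k, hk'⟩, rfl⟩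
    · exact Or.inl hz
  constructor
  · intro x y hx hy
    rcases hcases x with ⟨x, rfl⟩ | ⟨x, hx', rfl⟩ <;> rcases hcases y with ⟨y, rfl⟩ | ⟨y, hy', rfl⟩
    · rw [H₁.inr_inj (hG.subsingleton _ _ ((hτ x).trans hx) ((hτ y).trans hy))]
    · exact ((hnew y hy' hy).1 x ((hτ x).trans hx)).elim
    · exact ((hnew x hx' hx).1 y ((hτ y).trans hy)).elim
    · rw [hR x y hx hy]
  · intro x y hx hy
    rcases hcases x with ⟨x, rfl⟩ | ⟨x, hx', rfl⟩ <;> rcases hcases y with ⟨y, rfl⟩ | ⟨y, hy', rfl⟩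
    · exact hG.not_both _ _ ((hτ x).trans hx) ((hτ y).trans hy)
    · exact hold y hy' hy x ((hτ x).trans hx)
    · exact (hnew x hx' hx).2.1 y ((hτ y).trans hy)
    · exact (hnew x hx' hx).2.2 y hy' hy

/-- The invariant of the graphs derived without constraints: the original part is reachable in
the original grammar, and the complement of a shape occurs at most once, and only in the absence
of the body. Complement and body are represented by the negative item of the shape that
determines the others: the arc, if there is one, and otherwise the node. -/
structure Invariant (H : TGph (TGbar C)) : Prop where
  reach : ∃ G, Reachable C G ∧ Nonempty (G ≅ restrict H)
  arc : ∀ (σ : shapes C) (e : C.TG.E) (hb : e ∈ σ.1.body.E) (hn : e ∉ σ.1.border.E),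
    σ.1.IsArc e → Exclusive H.hom.e (newE σ hb hn) (Sum.inl e)
  node : ∀ (σ : shapes C) (b : C.TG.N) (hb : b ∈ σ.1.body.N) (hn : b ∉ σ.1.border.N),
    σ.1.IsNode b → Exclusive H.hom.n (newN σ hb hn) (Sum.inl b)

theorem Shape.IsArc.mem {T : Gph.{u}} {σ : Shape T} {e : T.E} (h : σ.IsArc e) : e ∈ σ.body.E := by
  rw [h.body_E]; rfl

theorem Shape.IsArc.notMem {T : Gph.{u}} {σ : Shape T} {e : T.E} (h : σ.IsArc e) :
    e ∉ σ.border.E := by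
  rw [h.border_E]; exact Set.notMem_empty _

theorem Shape.IsNode.mem {T : Gph.{u}} {σ : Shape T} {b : T.N} (h : σ.IsNode b) :
    b ∈ σ.body.N := by
  rw [h.body_N]; rfl

theorem Shape.IsNode.notMem {T : Gph.{u}} {σ : Shape T} {b : T.N} (h : σ.IsNode b) :
    b ∉ σ.border.N := by
  rw [h.border_N]; exact Set.notMem_empty _

theorem Shape.IsNode.border_le {T : Gph.{u}} {σ : Shape T} {b : T.N} (h : σ.IsNode b)
    (A : Sub T) : σ.border ≤ A :=
  ⟨by rw [h.border_N]; exact Set.empty_subset _, by rw [h.border_E]; exact Set.empty_subset _⟩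

theorem Shape.IsArc.body_le {T : Gph.{u}} {σ : Shape T} {e : T.E} (h : σ.IsArc e) {A : Sub T}
    (he : e ∈ A.E) : σ.body ≤ A := by
  constructor
  · rw [h.body_N]
    rintro _ (rfl | rfl)
    · exact A.hs _ he
    · exact A.ht _ he
  · rw [h.body_E]
    rintro _ rfl
    exact he

theorem Shape.IsNode.body_le {T : Gph.{u}} {σ : Shape T} {b : T.N} (h : σ.IsNode b) {A : Sub T}
    (hb : b ∈ A.N) : σ.body ≤ A := by
  constructor
  · rw [h.body_N]
    rintro _ rfl
    exact hb
  · rw [h.body_E]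
    exact Set.empty_subset _

theorem le_ofTyped {T : Gph.{u}} {A : Sub T} {H : TGph T} (f : A.typed ⟶ H) :
    A ≤ Sub.ofTyped H :=
  ⟨fun v hv => ⟨f.left.n ⟨v, hv⟩, trivial, typed_n f _⟩,
    fun v hv => ⟨f.left.e ⟨v, hv⟩, trivial, typed_e f _⟩⟩

theorem ofTyped_le_old {X : TGph C.TG} {H : TGph (TGbar C)} (f : X ⟶ restrict H) :
    Sub.ofTyped X ≤ (Sub.ofTyped H).old := by
  constructor
  · rintro _ ⟨x, -, rfl⟩
    refine ⟨(f.left.n x).1.2, trivial, (f.left.n x).2.symm.trans ?_⟩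
    exact congrArg Sum.inl (typed_n f x)
  · rintro _ ⟨x, -, rfl⟩
    refine ⟨(f.left.e x).1.2, trivial, (f.left.e x).2.symm.trans ?_⟩
    exact congrArg Sum.inl (typed_e f x)

theorem Invariant.restrict_inj {H : TGph (TGbar C)} (hsafe : Safe C) (h : Invariant H) :
    Gph.Inj (restrict H).hom := by
  obtain ⟨G, hG, ⟨e⟩⟩ := h.reach
  have he := Inj.of_iso e.symm
  have hi := hsafe.reachable_inj G hG
  rw [← Over.w e.inv]
  exact ⟨hi.1.comp he.1, hi.2.comp he.2⟩

theorem eq_of_old_n {H : TGph (TGbar C)} (h : Gph.Inj (restrict H).hom)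
    {v : C.TG.N} (x y : H.left.N) (hx : H.hom.n x = Sum.inl v) (hy : H.hom.n y = Sum.inl v) :
    x = y :=
  congrArg (fun z : (restrict H).left.N => z.1.2)
    (h.1 (a₁ := ⟨(v, x), hx.symm⟩) (a₂ := ⟨(v, y), hy.symm⟩) rfl)

theorem eq_of_old_e {H : TGph (TGbar C)} (h : Gph.Inj (restrict H).hom)
    {v : C.TG.E} (x y : H.left.E) (hx : H.hom.e x = Sum.inl v) (hy : H.hom.e y = Sum.inl v) :
    x = y :=
  congrArg (fun z : (restrict H).left.E => z.1.2)
    (h.2 (a₁ := ⟨(v, x), hx.symm⟩) (a₂ := ⟨(v, y), hy.symm⟩) rfl)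

/-- A graph satisfying the invariant that contains the left-hand side of a rule contains the body
of no constraint of the rule, since it contains the complement. -/
theorem Invariant.not_body_le (hS : ShapesCases C) {H : TGph (TGbar C)} (h : Invariant H)
    {p : C.P} {σ : shapes C} (hσ : σ ∈ ownShapes p) (f : (step3 p).L.typed ⟶ H) :
    ¬ σ.1.body ≤ (Sub.ofTyped H).old := by
  intro hle
  have hf := le_ofTyped f
  rw [step3_L hS] at hf
  rcases hS σ with ⟨e, he⟩ | ⟨b, hb⟩
  · obtain ⟨x, -, hx⟩ := hf.2 (Or.inr ((newE_mem_union _ σ he.mem he.notMem).2 (Or.inl hσ)))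
    obtain ⟨y, -, hy⟩ := hle.2 he.mem
    exact (h.arc σ e he.mem he.notMem he).not_both x y hx hy
  · obtain ⟨x, -, hx⟩ := hf.1 (Or.inr ((newN_mem_union _ σ hb.mem hb.notMem).2 (Or.inl hσ)))
    obtain ⟨y, -, hy⟩ := hle.1 hb.mem
    exact (h.node σ b hb.mem hb.notMem hb).not_both x y hx hy

theorem Invariant.satAll (hS : ShapesCases C) {H : TGph (TGbar C)} (h : Invariant H)
    {p : C.P} {Z : Set (shapes C)} (m : (finalRule p Z).L ⟶ H) :
    SatAll m (finalConstraint p Z '' C.nac p) := by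
  rintro _ ⟨c, hc, rfl⟩ ⟨q, -, -⟩
  have hσ : (⟨c.shape, p, c, hc, rfl⟩ : shapes C) ∈ ownShapes p := ⟨c, hc, rfl⟩
  refine h.not_body_le hS hσ (Sub.plusInl _ _ ≫ m) (c.shape_body_le.trans ?_)
  rw [← old_asSub]
  have := le_sup_left.trans (le_ofTyped (Sub.plusInl _ _ ≫ q) : asSub C c.N ⊔ (step3 p).L ≤ _)
  exact ⟨fun _ hv => this.1 hv, fun _ hv => this.2 hv⟩

/-- Below a transformation by a final rule there is a transformation by the original rule that
satisfies the original constraints. -/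
theorem Invariant.step_restrict (hS : ShapesCases C) (hsafe : Safe C) {p : C.P}
    {Z : Set (shapes C)} {G H : TGph (TGbar C)} {t : Diagram (finalRule p Z) G H}
    (ht : t.IsDPO) (h : Invariant G) : Reachable C (restrict H) := by
  obtain ⟨G₀, hG₀, ⟨e⟩⟩ := h.reach
  refine hG₀.step ⟨p, (t.restrict hS).transport e.symm,
    (ht.elementwise.restrict hS hsafe).isDPO.transport _, ?_⟩
  rintro c hc ⟨q, -, -⟩
  have hσ : (⟨c.shape, p, c, hc, rfl⟩ : shapes C) ∈ ownShapes p := ⟨c, hc, rfl⟩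
  exact h.not_body_le hS hσ (Sub.plusInl _ _ ≫ t.m)
    (c.shape_body_le.trans (ofTyped_le_old (q ≫ e.hom)))

theorem Invariant.start (hsafe : Safe C) :
    Invariant (invClosure C C.Gin).typed := by
  have hinj := hsafe.reachable_inj _ (Reachable.start C)
  have hset : {σ : shapes C | borderIn C σ ≤ asSub C C.Gin ∧ ¬ bodyIn C σ ≤ asSub C C.Gin} =
      {σ : shapes C | σ.1.border ≤ Sub.ofTyped C.Gin ∧ ¬ σ.1.body ≤ Sub.ofTyped C.Gin} := by
    simp only [bodyIn_le_iff, borderIn_le_iff, old_asSub]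
  have hold : (invClosure C C.Gin).old = Sub.ofTyped C.Gin := by
    rw [invClosure, hset]
    exact old_sup_union (old_asSub _) fun _ hσ => hσ.1
  have hmem : ∀ {σ : shapes C}, σ ∈ {σ : shapes C | borderIn C σ ≤ asSub C C.Gin ∧
      ¬ bodyIn C σ ≤ asSub C C.Gin} → ¬ σ.1.body ≤ (invClosure C C.Gin).old := by
    intro σ hσ
    rw [hset] at hσ
    rw [hold]
    exact hσ.2
  refine ⟨⟨C.Gin, Reachable.start C, nonempty_iso_of_bij (toRestrict hold.ge (𝟙 _))
    ⟨⟨fun x y h => ?_, ?_⟩, ⟨fun x y h => ?_, ?_⟩⟩⟩, ?_, ?_⟩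
  · exact hinj.1 (congrArg (fun z : (restrict (invClosure C C.Gin).typed).left.N => z.1.1) h)
  · rintro ⟨⟨v, x⟩, hx⟩
    have hx' : Sum.inl v = x.1 := hx
    obtain ⟨w, rfl⟩ := exists_of_mem_ofTyped_n hold (hx' ▸ x.2)
    exact ⟨w, Subtype.ext (Prod.ext rfl (Subtype.ext hx'))⟩
  · exact hinj.2 (congrArg (fun z : (restrict (invClosure C C.Gin).typed).left.E => z.1.1) h)
  · rintro ⟨⟨v, x⟩, hx⟩
    have hx' : Sum.inl v = x.1 := hx
    obtain ⟨w, rfl⟩ := exists_of_mem_ofTyped_e hold (hx' ▸ x.2)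
    exact ⟨w, Subtype.ext (Prod.ext rfl (Subtype.ext hx'))⟩
  · intro σ e hb hn he
    refine ⟨fun x y hx hy => Subtype.ext (hx.trans hy.symm), fun x y hx hy => ?_⟩
    have hx' : x.1 = newE σ hb hn := hx
    have hy' : y.1 = Sum.inl e := hy
    have h₁ := x.2
    have h₂ := y.2
    rw [hx'] at h₁
    rw [hy'] at h₂
    exact hmem ((newE_mem_union _ σ hb hn).1 (h₁.resolve_left (newE_notMem_map _ σ hb hn)))
      (he.body_le h₂)
  · intro σ b hb hn he
    refine ⟨fun x y hx hy => Subtype.ext (hx.trans hy.symm), fun x y hx hy => ?_⟩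
    have hx' : x.1 = newN σ hb hn := hx
    have hy' : y.1 = Sum.inl b := hy
    have h₁ := x.2
    have h₂ := y.2
    rw [hx'] at h₁
    rw [hy'] at h₂
    exact hmem ((newN_mem_union _ σ hb hn).1 (h₁.resolve_left (newN_notMem_map _ σ hb hn)))
      (he.body_le h₂)

/-! ### Preservation of the invariant -/

theorem newE_mem_finalR (hS : ShapesCases C) {p : C.P} {Z : Set (shapes C)} {σ : shapes C}
    {e : C.TG.E} {hb : e ∈ σ.1.body.E} {hn : e ∉ σ.1.border.E}
    (h : newE σ hb hn ∈ (finalR p Z).E) :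
    σ ∈ KeptShapes p ∨ DestroysBody p σ ∨ CreatesBorder p σ ∨ σ ∈ Z := by
  rw [finalR, step3_R hS] at h
  rcases h with (h | h) | h
  · exact (newE_notMem_map _ σ hb hn h).elim
  · rcases (newE_mem_union _ σ hb hn).1 h with (h | h) | h
    · exact Or.inl h
    · exact Or.inr (Or.inl h)
    · exact Or.inr (Or.inr (Or.inl h))
  · exact Or.inr (Or.inr (Or.inr ((newE_mem_union _ σ hb hn).1 h)))

theorem newN_mem_finalR (hS : ShapesCases C) {p : C.P} {Z : Set (shapes C)} {σ : shapes C}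
    {b : C.TG.N} {hb : b ∈ σ.1.body.N} {hn : b ∉ σ.1.border.N}
    (h : newN σ hb hn ∈ (finalR p Z).N) :
    σ ∈ KeptShapes p ∨ DestroysBody p σ ∨ CreatesBorder p σ ∨ σ ∈ Z := by
  rw [finalR, step3_R hS] at h
  rcases h with (h | h) | h
  · exact (newN_notMem_map _ σ hb hn h).elim
  · rcases (newN_mem_union _ σ hb hn).1 h with (h | h) | h
    · exact Or.inl h
    · exact Or.inr (Or.inl h)
    · exact Or.inr (Or.inr (Or.inl h))
  · exact Or.inr (Or.inr (Or.inr ((newN_mem_union _ σ hb hn).1 h)))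

theorem newE_mem_step3_L (hS : ShapesCases C) {p : C.P} {σ : shapes C} {e : C.TG.E}
    (hb : e ∈ σ.1.body.E) (hn : e ∉ σ.1.border.E) (h : σ ∈ ownShapes p ∨ CreatesBody p σ) :
    newE σ hb hn ∈ (step3 p).L.E := by
  rw [step3_L hS]
  exact Or.inr ((newE_mem_union _ σ hb hn).2 h)

theorem newN_mem_step3_L (hS : ShapesCases C) {p : C.P} {σ : shapes C} {b : C.TG.N}
    (hb : b ∈ σ.1.body.N) (hn : b ∉ σ.1.border.N) (h : σ ∈ ownShapes p ∨ CreatesBody p σ) :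
    newN σ hb hn ∈ (step3 p).L.N := by
  rw [step3_L hS]
  exact Or.inr ((newN_mem_union _ σ hb hn).2 h)

theorem newE_mem_step3_K {p : C.P} {σ : shapes C} {e : C.TG.E} (hb : e ∈ σ.1.body.E)
    (hn : e ∉ σ.1.border.E) : newE σ hb hn ∈ (step3 p).K.E ↔ σ ∈ KeptShapes p := by
  rw [step3_K, ← newE_mem_union (KeptShapes p) σ hb hn]
  exact ⟨fun h => h.resolve_left (newE_notMem_map _ σ hb hn), Or.inr⟩

theorem newN_mem_step3_K {p : C.P} {σ : shapes C} {b : C.TG.N} (hb : b ∈ σ.1.body.N)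
    (hn : b ∉ σ.1.border.N) : newN σ hb hn ∈ (step3 p).K.N ↔ σ ∈ KeptShapes p := by
  rw [step3_K, ← newN_mem_union (KeptShapes p) σ hb hn]
  exact ⟨fun h => h.resolve_left (newN_notMem_map _ σ hb hn), Or.inr⟩

theorem inl_mem_step3_K_n (hS : ShapesCases C) {p : C.P} {v : C.TG.N} :
    Sum.inl v ∈ (step3 p).K.N ↔ v ∈ (Sub.ofTyped (C.rule p).K).N := by
  rw [← old_step3_K hS]; rfl

theorem inl_mem_step3_K_e (hS : ShapesCases C) {p : C.P} {v : C.TG.E} :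
    Sum.inl v ∈ (step3 p).K.E ↔ v ∈ (Sub.ofTyped (C.rule p).K).E := by
  rw [← old_step3_K hS]; rfl

theorem inl_mem_step3_R_e (hS : ShapesCases C) {p : C.P} {v : C.TG.E} :
    Sum.inl v ∈ (step3 p).R.E ↔ v ∈ (Sub.ofTyped (C.rule p).R).E := by
  rw [← old_step3_R hS]; rfl

/-- The negative arc of a shape and its complement are both incident with the border nodes. -/
theorem incident_of_mem_border {σ : shapes C} {e : C.TG.E} (he : σ.1.IsArc e)
    {hb : e ∈ σ.1.body.E} {hn : e ∉ σ.1.border.E} {w : C.TG.N} (hw : w ∈ σ.1.border.N) :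
    ((TGbar C).s (Sum.inl e) = Sum.inl w ∧ (TGbar C).s (newE σ hb hn) = Sum.inl w) ∨
    ((TGbar C).t (Sum.inl e) = Sum.inl w ∧ (TGbar C).t (newE σ hb hn) = Sum.inl w) := by
  have h := σ.1.le.1 hw
  rw [he.body_N] at h
  rcases h with rfl | rfl
  · refine Or.inl ⟨rfl, ?_⟩
    change barN σ ⟨C.TG.s e, _⟩ = _
    simp only [barN, dif_pos hw]
  · refine Or.inr ⟨rfl, ?_⟩
    change barN σ ⟨C.TG.t e, _⟩ = _
    simp only [barN, dif_pos hw]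

section Step

variable {p : C.P} {Z : Set (shapes C)} {G H : TGph (TGbar C)} {t : Diagram (finalRule p Z) G H}

/-- If a rule creates a node of the border, then neither the arc of the body nor the complemented
arc can be preserved, since the graph obtained contains the node only once. -/
theorem ElementwiseDPO.not_preserved_of_created (hS : ShapesCases C) (ht : ElementwiseDPO t)
    (hH : Gph.Inj (GraphGrammar.restrict H).hom) {σ : shapes C} {e : C.TG.E} (he : σ.1.IsArc e)
    {hb : e ∈ σ.1.body.E} {hn : e ∉ σ.1.border.E} {w : C.TG.N} (hw : w ∈ σ.1.border.N)
    (hwR : w ∈ (Sub.ofTyped (C.rule p).R).N) (hwK : w ∉ (Sub.ofTyped (C.rule p).K).N)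
    (z : t.D.left.E) : t.D.hom.e z ≠ Sum.inl e ∧ t.D.hom.e z ≠ newE σ hb hn := by
  have hwR' := (inl_mem_step3_R hS).2 hwR
  have key : ∀ z : t.D.left.N, t.D.hom.n z ≠ Sum.inl w := by
    intro z hz
    refine ht.right_n.not_preserved (τ := H.hom.n) (y := Sum.inl w) (eq_of_old_n hH)
      (b := ⟨Sum.inl w, Or.inl hwR'⟩) (typed_n t.c _) ?_ z ((typed_n t.h z).trans hz)
    rintro (k | s) hk
    · have hk' : k.1 = Sum.inl w := congrArg Subtype.val hk
      exact hwK ((inl_mem_step3_K_n hS).1 (hk' ▸ k.2))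
    · have hs : s.1 = Sum.inl w := congrArg Subtype.val hk
      obtain ⟨_, _, _, h⟩ := s.2
      exact h (hs ▸ hwR')
  rcases incident_of_mem_border he (hb := hb) (hn := hn) hw with h | h
  · exact ⟨fun hz => key (t.D.left.s z) ((t.D.hom.hs z).trans ((congrArg _ hz).trans h.1)),
      fun hz => key (t.D.left.s z) ((t.D.hom.hs z).trans ((congrArg _ hz).trans h.2))⟩
  · exact ⟨fun hz => key (t.D.left.t z) ((t.D.hom.ht z).trans ((congrArg _ hz).trans h.1)),
      fun hz => key (t.D.left.t z) ((t.D.hom.ht z).trans ((congrArg _ hz).trans h.2))⟩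

/-- Exclusiveness of a complemented arc is preserved. The complement can be created because the body
is destroyed or because part of the border is created, and the body can be created with or without
part of the border. -/
theorem Invariant.step_arc (hS : ShapesCases C) (hsafe : Safe C) (hZ : Completion p Z)
    (ht : ElementwiseDPO t) (h : Invariant G) (hH : Gph.Inj (restrict H).hom) {σ : shapes C}
    {e : C.TG.E} (hb : e ∈ σ.1.body.E) (hn : e ∉ σ.1.border.E) (he : σ.1.IsArc e) :
    Exclusive H.hom.e (newE σ hb hn) (Sum.inl e) := by
  have hG := h.arc σ e hb hn he
  have hinj := h.restrict_inj hsafe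
  have hgD : ∀ z, G.hom.e (t.g.left.e z) = t.D.hom.e z := typed_e t.g
  -- the left-hand side does not contain both the body and its complement
  have hboth : newE σ hb hn ∈ (step3 p).L.E → Sum.inl e ∈ (step3 p).L.E → False := fun h₁ h₂ =>
    hG.not_both (t.m.left.e ⟨_, h₁⟩) (t.m.left.e ⟨_, h₂⟩) (typed_e t.m _) (typed_e t.m _)
  have hRold : ∀ x : (finalR p Z).E, (finalR p Z).typed.hom.e x = Sum.inl e →
      σ.1.body ≤ Sub.ofTyped (C.rule p).R := fun x hx => by
    have hx' : x.1 = Sum.inl e := hx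
    exact he.body_le ((inl_mem_step3_R_e hS).1 (inl_mem_finalR_e hS (hx' ▸ x.2)))
  -- a created arc of the body is not in the interface
  have hKold : ∀ x : (finalR p Z).E, (∀ k, (finalRule p Z).r.left.e k ≠ x) →
      (finalR p Z).typed.hom.e x = Sum.inl e → ¬ σ.1.body ≤ Sub.ofTyped (C.rule p).K :=
    fun x hk hx hle => hk ⟨Sum.inl e, (inl_mem_step3_K_e hS).2 (hle.2 hb)⟩ (Subtype.ext hx.symm)
  have hdel : newE σ hb hn ∈ (step3 p).L.E → σ ∉ KeptShapes p →
      ∀ z, G.hom.e (t.g.left.e z) ≠ newE σ hb hn := by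
    intro hL hK
    refine ht.left_e.not_preserved hG.subsingleton (b := ⟨_, hL⟩) (typed_e t.m _) ?_
    intro k hk
    have hk' : k.1 = newE σ hb hn := congrArg Subtype.val hk
    exact hK ((newE_mem_step3_K hb hn).1 (hk' ▸ k.2))
  refine hG.of_setPO ht.left_e ht.right_e
    (fun x => (typed_e t.g x).trans (typed_e t.h x).symm) ?_ ?_ ?_
  · intro x y hx hy
    exact Subtype.ext (((typed_e t.c x).symm.trans hx).trans ((typed_e t.c y).symm.trans hy).symm)
  · intro x hxK hx
    have hx' : x.1 = newE σ hb hn := (typed_e t.c x).symm.trans hx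
    -- the complement is created together with a border node
    have hborder : (∃ w ∈ σ.1.border.N, w ∈ (Sub.ofTyped (C.rule p).R).N ∧
        w ∉ (Sub.ofTyped (C.rule p).K).N) → ¬ σ.1.body ≤ Sub.ofTyped (C.rule p).R →
        (∀ z, G.hom.e (t.g.left.e z) ≠ newE σ hb hn) ∧
        (∀ z, G.hom.e (t.g.left.e z) ≠ Sum.inl e) ∧
        ∀ y, (∀ k, (finalRule p Z).r.left.e k ≠ y) → H.hom.e (t.c.left.e y) ≠ Sum.inl e := by
      rintro ⟨w, hw, hwR, hwK⟩ hno
      have hp := ht.not_preserved_of_created hS hH he (hb := hb) (hn := hn) hw hwR hwK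
      exact ⟨fun z hz => (hp z).2 ((hgD z).symm.trans hz),
        fun z hz => (hp z).1 ((hgD z).symm.trans hz),
        fun y _ hy => hno (hRold y ((typed_e t.c y).symm.trans hy))⟩
    rcases newE_mem_finalR hS (hx' ▸ x.2) with hσ | hσ | hσ | hσ
    · exact (hxK ⟨_, (newE_mem_step3_K hb hn).2 hσ⟩ (Subtype.ext hx'.symm)).elim
    · have hL : Sum.inl e ∈ (step3 p).L.E := ((ofTyped_L_le hS p).2 (hσ.body_le.2 hb) :)
      refine ⟨fun z hz => hG.not_both _ (t.m.left.e ⟨_, hL⟩) hz (typed_e t.m _), ?_, ?_⟩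
      · refine ht.left_e.not_preserved (eq_of_old_e hinj) (b := ⟨_, hL⟩) (typed_e t.m _) ?_
        intro k hk
        have hk' : k.1 = Sum.inl e := congrArg Subtype.val hk
        exact hσ.not_body_le (he.body_le ((inl_mem_step3_K_e hS).1 (hk' ▸ k.2)))
      · intro y hyK hy
        have hy' := (typed_e t.c y).symm.trans hy
        exact hboth (newE_mem_step3_L hS hb hn
          (Or.inr ⟨hσ.other, hRold y hy', hσ.not_body_le, hσ.border_le⟩)) hL
    · refine hborder ?_ hσ.not_body_le
      by_contra hno
      push Not at hno
      refine hσ.not_border_le ⟨fun w hw => hno w hw (hσ.border_le.1 hw), ?_⟩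
      rw [hS.border_E]
      exact Set.empty_subset _
    · have hc := hZ.completesBorder hS σ hσ
      exact hborder hc.created fun hle => hc.not_border_le (σ.1.le.trans hle)
  · intro x hxK hx z hz
    have hx' := (typed_e t.c x).symm.trans hx
    have hR := hRold x hx'
    have hK := hKold x hxK hx'
    by_cases hown : σ ∈ ownShapes p
    · refine hdel (newE_mem_step3_L hS hb hn (Or.inl hown)) (fun hk => hk.2.2 ?_) z hz
      rw [bodyIn_le_iff]
      exact hR.trans (old_asSub _).ge
    · by_cases hle : σ.1.border ≤ Sub.ofTyped (C.rule p).K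
      · exact hdel (newE_mem_step3_L hS hb hn (Or.inr ⟨hown, hR, hK, hle⟩))
          (fun hk => hown hk.1) z hz
      · obtain ⟨w, hw, hwK⟩ : ∃ w ∈ σ.1.border.N, w ∉ (Sub.ofTyped (C.rule p).K).N := by
          by_contra hno
          push Not at hno
          refine hle ⟨hno, ?_⟩
          rw [hS.border_E]
          exact Set.empty_subset _
        exact (ht.not_preserved_of_created hS hH he (hb := hb) (hn := hn) hw
          ((σ.1.le.trans hR).1 hw) hwK z).2 ((hgD z).symm.trans hz)

/-- Exclusiveness of a complemented node is preserved. The border is empty, so only destruction and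
creation of the body matter. -/
theorem Invariant.step_node (hS : ShapesCases C) (hsafe : Safe C) (hZ : Completion p Z)
    (ht : ElementwiseDPO t) (h : Invariant G) {σ : shapes C}
    {b : C.TG.N} (hb : b ∈ σ.1.body.N) (hn : b ∉ σ.1.border.N) (hσb : σ.1.IsNode b) :
    Exclusive H.hom.n (newN σ hb hn) (Sum.inl b) := by
  have hG := h.node σ b hb hn hσb
  have hinj := h.restrict_inj hsafe
  -- the left-hand side does not contain both the body and its complement
  have hboth : newN σ hb hn ∈ (step3 p).L.N → Sum.inl b ∈ (step3 p).L.N → False := fun h₁ h₂ =>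
    hG.not_both (t.m.left.n (Sum.inl ⟨_, h₁⟩)) (t.m.left.n (Sum.inl ⟨_, h₂⟩))
      (typed_n t.m _) (typed_n t.m _)
  -- a created node of type `b` belongs to the original right-hand side and not to the interface
  have hRold : ∀ x : (finalR p Z).N, (∀ k, (finalRule p Z).r.left.n k ≠ x) →
      (finalR p Z).typed.hom.n x = Sum.inl b → σ.1.body ≤ Sub.ofTyped (C.rule p).R := by
    intro x hk hx
    have hx' : x.1 = Sum.inl b := hx
    rcases inl_mem_finalR_n (hx' ▸ x.2) with h | h
    · exact hσb.body_le ((inl_mem_step3_R hS).1 h)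
    · exact (hk (Sum.inr ⟨_, h⟩) (Subtype.ext hx.symm)).elim
  have hKold : ∀ x : (finalR p Z).N, (∀ k, (finalRule p Z).r.left.n k ≠ x) →
      (finalR p Z).typed.hom.n x = Sum.inl b → ¬ σ.1.body ≤ Sub.ofTyped (C.rule p).K :=
    fun x hk hx hle => hk (Sum.inl ⟨Sum.inl b, (inl_mem_step3_K_n hS).2 (hle.1 hb)⟩)
      (Subtype.ext hx.symm)
  have hdel : newN σ hb hn ∈ (step3 p).L.N → σ ∉ KeptShapes p →
      ∀ z, G.hom.n (t.g.left.n z) ≠ newN σ hb hn := by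
    intro hL hK
    refine ht.left_n.not_preserved hG.subsingleton (b := Sum.inl ⟨_, hL⟩) (typed_n t.m _) ?_
    rintro (k | s) hk
    · have hk' : k.1 = newN σ hb hn := congrArg Subtype.val (Sum.inl.inj hk)
      exact hK ((newN_mem_step3_K hb hn).1 (hk' ▸ k.2))
    · cases hk
  refine hG.of_setPO ht.left_n ht.right_n
    (fun x => (typed_n t.g x).trans (typed_n t.h x).symm) ?_ ?_ ?_
  · intro x y hx hy
    exact Subtype.ext (((typed_n t.c x).symm.trans hx).trans ((typed_n t.c y).symm.trans hy).symm)
  · intro x hxK hx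
    have hx' : x.1 = newN σ hb hn := (typed_n t.c x).symm.trans hx
    rcases newN_mem_finalR hS (hx' ▸ x.2) with hσ | hσ | hσ | hσ
    · exact (hxK (Sum.inl ⟨_, (newN_mem_step3_K hb hn).2 hσ⟩) (Subtype.ext hx'.symm)).elim
    · have hL : Sum.inl b ∈ (step3 p).L.N := ((ofTyped_L_le hS p).1 (hσ.body_le.1 hb) :)
      refine ⟨fun z hz => hG.not_both _ (t.m.left.n (Sum.inl ⟨_, hL⟩)) hz (typed_n t.m _), ?_, ?_⟩
      · refine ht.left_n.not_preserved (eq_of_old_n hinj) (b := Sum.inl ⟨_, hL⟩)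
          (typed_n t.m _) ?_
        rintro (k | s) hk
        · have hk' : k.1 = Sum.inl b := congrArg Subtype.val (Sum.inl.inj hk)
          exact hσ.not_body_le (hσb.body_le ((inl_mem_step3_K_n hS).1 (hk' ▸ k.2)))
        · cases hk
      · intro y hyK hy
        have hy' := (typed_n t.c y).symm.trans hy
        exact hboth (newN_mem_step3_L hS hb hn
          (Or.inr ⟨hσ.other, hRold y hyK hy', hσ.not_body_le, hσ.border_le⟩)) hL
    -- the border is empty, so that it is not created
    · exact (hσ.not_border_le (hσb.border_le _)).elim
    · exact ((hZ.completesBorder hS σ hσ).not_border_le (hσb.border_le _)).elim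
  · intro x hxK hx z hz
    have hx' := (typed_n t.c x).symm.trans hx
    have hR := hRold x hxK hx'
    have hK := hKold x hxK hx'
    by_cases hown : σ ∈ ownShapes p
    · refine hdel (newN_mem_step3_L hS hb hn (Or.inl hown)) (fun hk => hk.2.2 ?_) z hz
      rw [bodyIn_le_iff]
      exact hR.trans (old_asSub _).ge
    · exact hdel (newN_mem_step3_L hS hb hn (Or.inr ⟨hown, hR, hK, hσb.border_le _⟩))
        (fun hk => hown hk.1) z hz

/-- The invariant is preserved by all transformations without constraints. -/
theorem Invariant.step (hS : ShapesCases C) (hsafe : Safe C) (hZ : Completion p Z)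
    (ht : t.IsDPO) (h : Invariant G) : Invariant H := by
  have hr := h.step_restrict hS hsafe ht
  have hH := hsafe.reachable_inj _ hr
  exact ⟨⟨_, hr, ⟨Iso.refl _⟩⟩,
    fun σ e hb hn he => h.step_arc hS hsafe hZ ht.elementwise hH hb hn he,
    fun σ b hb hn hσ => h.step_node hS hsafe hZ ht.elementwise hb hn hσ⟩

end Step

theorem Invariant.derivation (hS : ShapesCases C) (hsafe : Safe C) {k : ℕ}
    (s : Derivation (enrichedGrammar C).dropNACs k) (i : Fin (k + 1)) : Invariant (s.G i) := by
  induction i using Fin.induction with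
  | zero =>
    rw [s.start]
    exact Invariant.start hsafe
  | succ i ih => exact ih.step hS hsafe (s.p i).2.2 (s.dpo i)

/-! ### Retyping along the identity span -/

section Identity

variable {T : Gph.{u}}

/-- Retyping along the identity span is isomorphic to the identity. -/
def retypeId (X : TGph T) : X ≅ (TypeSpan.id T).retype.obj X where
  hom := mkHom (B := (TypeSpan.id T).retype.obj X)
    (fun x => ⟨(X.hom.n x, x), rfl⟩) (fun x => ⟨(X.hom.e x, x), rfl⟩)
    (fun x => Subtype.ext (Prod.ext (X.hom.hs x) rfl))
    (fun x => Subtype.ext (Prod.ext (X.hom.ht x) rfl)) (fun _ => rfl) (fun _ => rfl)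
  inv := mkHom (A := (TypeSpan.id T).retype.obj X)
    (fun x => x.1.2) (fun x => x.1.2) (fun _ => rfl) (fun _ => rfl)
    (fun x => x.2.symm) (fun x => x.2.symm)
  hom_inv_id := tgph_ext (fun _ => rfl) (fun _ => rfl)
  inv_hom_id := tgph_ext (fun x => Subtype.ext (Prod.ext x.2.symm rfl))
    (fun x => Subtype.ext (Prod.ext x.2.symm rfl))

theorem retypeId_naturality {X Y : TGph T} (f : X ⟶ Y) :
    f ≫ (retypeId Y).hom = (retypeId X).hom ≫ (TypeSpan.id T).retype.map f :=
  tgph_ext (fun x => Subtype.ext (Prod.ext (typed_n f x) rfl))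
    (fun x => Subtype.ext (Prod.ext (typed_e f x) rfl))

theorem retypeId_naturality_inv {X Y : TGph T} (f : X ⟶ Y) :
    (TypeSpan.id T).retype.map f ≫ (retypeId Y).inv = (retypeId X).inv ≫ f := rfl

theorem retypeId_conj {X Y : TGph T} (f : X ⟶ Y) :
    ((retypeId X).hom ≫ (TypeSpan.id T).retype.map f) ≫ (retypeId Y).inv = f := rfl

theorem retypeId_triangle {A X Y : TGph T} {f : A ⟶ X} {g : X ⟶ Y} {h : A ⟶ Y} (w : f ≫ g = h) :
    (f ≫ (retypeId X).hom) ≫ (TypeSpan.id T).retype.map g = f ≫ g ≫ (retypeId Y).hom ∧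
    (f ≫ (retypeId X).hom) ≫ (TypeSpan.id T).retype.map g =
      (retypeId A).hom ≫ (TypeSpan.id T).retype.map h := by
  have h₁ : (f ≫ (retypeId X).hom) ≫ (TypeSpan.id T).retype.map g =
      f ≫ g ≫ (retypeId Y).hom := by
    rw [Category.assoc, ← retypeId_naturality]
  exact ⟨h₁, by rw [h₁, ← retypeId_naturality, ← w, Category.assoc]⟩

theorem retypeId_triangle_inv {A X Y : TGph T} {f : A ⟶ (TypeSpan.id T).retype.obj X}
    {g : X ⟶ Y} {h : A ⟶ Y}
    (w : f ≫ (TypeSpan.id T).retype.map g = (retypeId A).hom ≫ (TypeSpan.id T).retype.map h) :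
    (f ≫ (retypeId X).inv) ≫ g = h := by
  rw [Category.assoc, ← retypeId_naturality_inv, ← Category.assoc, w, ← retypeId_naturality,
    Category.assoc, Iso.hom_inv_id, Category.comp_id]

/-- Every rule is an ancestor of its retyping along the identity span. -/
def Ancestor.refl (p : Rule T) : Ancestor (TypeSpan.id T) p p where
  iL := (retypeId p.L).hom
  iK := (retypeId p.K).hom
  iR := (retypeId p.R).hom
  iL_inj := Inj.of_iso _
  iK_inj := Inj.of_iso _
  iR_inj := Inj.of_iso _
  left := IsPushout.of_vert_isIso ⟨retypeId_naturality p.l⟩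
  right := IsPushout.of_vert_isIso ⟨retypeId_naturality p.r⟩

end Identity

theorem injective_typing_finalK (p : C.P) (Z : Set (shapes C)) :
    Gph.Inj (finalRule p Z).K.hom := by
  constructor
  · rintro (x | x) (y | y) h
    · exact congrArg Sum.inl (Subtype.ext h)
    · have h' : x.1 = y.1 := h
      exact (Set.disjoint_left.mp (disjoint_addedNodes p Z) x.2 (h' ▸ y.2)).elim
    · have h' : x.1 = y.1 := h
      exact (Set.disjoint_left.mp (disjoint_addedNodes p Z) y.2 (h' ▸ x.2)).elim
    · exact congrArg Sum.inr (Subtype.ext h)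
  · exact Subtype.val_injective

/-- A monic endomorphism of the left-hand side of a final rule that fixes the interface is the
identity: the left-hand side has at most two nodes of each type, and if it has two, then one of
them belongs to the interface. -/
theorem finalL_rigid {p : C.P} {Z : Set (shapes C)}
    (f : (finalRule p Z).L ⟶ (finalRule p Z).L) (hf : Inj f)
    (h : (finalRule p Z).l ≫ f = (finalRule p Z).l) : f = 𝟙 _ := by
  -- an added node belongs to the interface
  have hr : ∀ s, f.left.n (Sum.inr s) = Sum.inr s := fun s =>
    Gph.hom_n_congr (congrArg CommaMorphism.left h) (Sum.inr s)
  refine tgph_ext ?_ fun x => Subtype.ext (typed_e f x)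
  rintro (x | s)
  · have ht := typed_n f (Sum.inl x)
    rcases hx : f.left.n (Sum.inl x) with y | s
    · rw [hx] at ht
      exact congrArg Sum.inl (Subtype.ext ht)
    · have := hf.1 (hx.trans (hr s).symm)
      cases this
  · exact hr s

section Ancestors

variable {p : C.P} {Z : Set (shapes C)}
  (a : Ancestor (TypeSpan.id (TGbar C)) (finalRule p Z) (finalRule p Z))

theorem Ancestor.iR_eq : a.iR = (retypeId _).hom := by
  rw [← cancel_mono (retypeId (finalRule p Z).R).inv]
  exact eq_of_injective_typing (B := (finalRule p Z).R)
    ⟨Subtype.val_injective, Subtype.val_injective⟩ _ _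

theorem Ancestor.iL_eq : a.iL = (retypeId _).hom := by
  have hK : a.iK ≫ (retypeId (finalRule p Z).K).inv = 𝟙 _ :=
    eq_of_injective_typing (injective_typing_finalK p Z) _ _
  have h : (finalRule p Z).l ≫ a.iL ≫ (retypeId (finalRule p Z).L).inv = (finalRule p Z).l := by
    rw [← Category.assoc, a.left.w, Category.assoc, retypeId_naturality_inv, ← Category.assoc, hK,
      Category.id_comp]
  have := finalL_rigid _ (Inj.comp a.iL_inj (Inj.of_iso (retypeId _).symm)) h
  rw [← cancel_mono (retypeId (finalRule p Z).L).inv, Iso.hom_inv_id]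
  exact this

end Ancestors

/-! ### The grammar morphism that deletes the constraints -/

theorem Derivation.dropNACs {C : CGG.{u, v}} {k : ℕ} (s : Derivation C k) :
    ∃ s' : Derivation C.dropNACs k, (∀ i, s'.p i = s.p i) ∧ ∀ i, s'.G i = s.G i :=
  ⟨⟨s.G, s.start, s.p, s.t, s.dpo, fun _ _ h => h.elim⟩, fun _ => rfl, fun _ => rfl⟩

theorem Invariant.of_reachable (hS : ShapesCases C) (hsafe : Safe C) {G : TGph (TGbar C)}
    (h : Reachable (enrichedGrammar C) G) : Invariant G := by
  obtain ⟨_, s, rfl⟩ := h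
  obtain ⟨s', -, hs⟩ := s.dropNACs
  rw [← hs]
  exact Invariant.derivation hS hsafe s' _

theorem isMorphism_dropNACs (D : CGG.{u, v}) :
    IsMorphism D D.dropNACs (TypeSpan.id D.TG) id where
  left_inj := ⟨fun _ _ h => h, fun _ _ h => h⟩
  input := ⟨(retypeId D.Gin).symm⟩
  rules p := ⟨Ancestor.refl (D.rule p), fun _ ⟨_, h, _⟩ => h.elim⟩

theorem preservesDerivations_dropNACs (D : CGG.{u, v}) :
    PreservesDerivations D D.dropNACs (TypeSpan.id D.TG) id := by
  intro k s
  obtain ⟨s', hp, hG⟩ := s.dropNACs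
  exact ⟨s', hp, fun i => ⟨(retypeId (s.G i)).symm ≪≫ eqToIso (hG i).symm⟩⟩

theorem reflectsDerivations_enrichedGrammar (hS : ShapesCases C) (hsafe : Safe C) :
    ReflectsDerivations (enrichedGrammar C) (enrichedGrammar C).dropNACs
      (TypeSpan.id (enrichedGrammar C).TG) id := fun _ s =>
  ⟨⟨s.G, s.start, s.p, s.t, s.dpo,
    fun i => (Invariant.derivation hS hsafe s i.castSucc).satAll hS (s.t i).m⟩,
    fun _ => rfl, fun i => ⟨(retypeId (s.G i)).symm⟩⟩

theorem preservesSeqIndep_enrichedGrammar (C : CGG.{u, v}) :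
    PreservesSeqIndep (enrichedGrammar C) (enrichedGrammar C).dropNACs
      (TypeSpan.id (enrichedGrammar C).TG) id := by
  rintro p₁ p₂ G H₁ H₂ t₁ t₂ a₁ a₂ - ⟨i, j, hi, hj, -, H', t, k, ht, hm, hk, -⟩
  refine ⟨i ≫ (retypeId _).hom, j ≫ (retypeId _).hom, ?_, ?_, fun _ h => h.elim, H',
    t.transport (retypeId G), k, ht.transport _, ?_, ?_, fun _ h => h.elim⟩
  · exact (retypeId_triangle hi).2.trans
      (congrArg (· ≫ (TypeSpan.id (TGbar C)).retype.map t₁.c) (Ancestor.iR_eq a₁).symm)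
  · exact (retypeId_triangle hj).2.trans
      (congrArg (· ≫ (TypeSpan.id (TGbar C)).retype.map t₂.m) (Ancestor.iL_eq a₂).symm)
  · exact (congrArg (· ≫ (retypeId G).hom) hm).trans (retypeId_triangle (T := TGbar C) rfl).1.symm
  · refine Eq.trans ?_ ((retypeId_naturality t₁.m).trans
      (congrArg (· ≫ (TypeSpan.id (TGbar C)).retype.map t₁.m) (Ancestor.iL_eq a₁).symm))
    exact congrArg (· ≫ (retypeId G).hom) hk

theorem reflectsSeqIndep_enrichedGrammar (hS : ShapesCases C) (hsafe : Safe C) :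
    ReflectsSeqIndep (enrichedGrammar C) (enrichedGrammar C).dropNACs
      (TypeSpan.id (enrichedGrammar C).TG) id := by
  rintro p₁ p₂ G H₁ H₂ t₁ t₂ a₁ a₂ hc ⟨i, j, hi, hj, -, H', t, k, ht, hm, hk, -⟩
  have hG := Invariant.of_reachable hS hsafe hc.reachable
  have ht' : (t.transport (retypeId G).symm).IsDPO := ht.transport _
  have hH' : Invariant H' := hG.step hS hsafe p₂.2.2 ht'
  refine ⟨i ≫ (retypeId _).inv, j ≫ (retypeId _).inv, ?_, ?_, hG.satAll hS _, H',
    t.transport (retypeId G).symm, k, ht', ?_, ?_, hH'.satAll hS _⟩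
  · exact retypeId_triangle_inv (hi.trans
      (congrArg (· ≫ (TypeSpan.id (TGbar C)).retype.map t₁.c) (Ancestor.iR_eq a₁)))
  · exact retypeId_triangle_inv (hj.trans
      (congrArg (· ≫ (TypeSpan.id (TGbar C)).retype.map t₂.m) (Ancestor.iL_eq a₂)))
  · exact congrArg (· ≫ (retypeId G).inv) hm
  · refine (congrArg (· ≫ (retypeId G).inv) (hk.trans
      (congrArg (· ≫ (TypeSpan.id (TGbar C)).retype.map t₁.m) (Ancestor.iL_eq a₁)))).trans ?_
    exact retypeId_conj (T := TGbar C) t₁.m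

end GraphGrammar

theorem mainTheorem2 (C : GraphGrammar.CGG.{u, v})
    (hsafe : GraphGrammar.Safe C)
    (hinc : ∀ p, ∀ c ∈ C.nac p, GraphGrammar.Incremental c)
    (hiso : ∀ p, ∀ c ∈ C.nac p, ¬ GraphGrammar.Gph.Bij c.n.left) :
    -- the pair of the identity span and the identity map is a grammar morphism
    GraphGrammar.IsMorphism (GraphGrammar.enrichedGrammar C)
      (GraphGrammar.enrichedGrammar C).dropNACs
      (GraphGrammar.TypeSpan.id (GraphGrammar.enrichedGrammar C).TG) id ∧
    -- it preserves and reflects derivations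
    GraphGrammar.PreservesDerivations (GraphGrammar.enrichedGrammar C)
      (GraphGrammar.enrichedGrammar C).dropNACs
      (GraphGrammar.TypeSpan.id (GraphGrammar.enrichedGrammar C).TG) id ∧
    GraphGrammar.ReflectsDerivations (GraphGrammar.enrichedGrammar C)
      (GraphGrammar.enrichedGrammar C).dropNACs
      (GraphGrammar.TypeSpan.id (GraphGrammar.enrichedGrammar C).TG) id ∧
    -- every derivation without NACs satisfies the NACs at each of its steps
    (∀ (k : ℕ) (s : GraphGrammar.Derivation (GraphGrammar.enrichedGrammar C).dropNACs k)
      (i : Fin k), GraphGrammar.SatAll (s.t i).m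
        ((GraphGrammar.enrichedGrammar C).nac (s.p i))) ∧
    -- it preserves and reflects sequential independence
    GraphGrammar.PreservesSeqIndep (GraphGrammar.enrichedGrammar C)
      (GraphGrammar.enrichedGrammar C).dropNACs
      (GraphGrammar.TypeSpan.id (GraphGrammar.enrichedGrammar C).TG) id ∧
    GraphGrammar.ReflectsSeqIndep (GraphGrammar.enrichedGrammar C)
      (GraphGrammar.enrichedGrammar C).dropNACs
      (GraphGrammar.TypeSpan.id (GraphGrammar.enrichedGrammar C).TG) id := by
  have hS := GraphGrammar.ShapesCases.of_incremental hinc hiso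
  exact ⟨GraphGrammar.isMorphism_dropNACs _, GraphGrammar.preservesDerivations_dropNACs _,
    GraphGrammar.reflectsDerivations_enrichedGrammar hS hsafe,
    fun k s i => (GraphGrammar.Invariant.derivation hS hsafe s i.castSucc).satAll hS (s.t i).m,
    GraphGrammar.preservesSeqIndep_enrichedGrammar C,
    GraphGrammar.reflectsSeqIndep_enrichedGrammar hS hsafe⟩
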